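/- Let $G$ be a finite, non-empty, simple undirected graph, let $\chi\colon V(G)\to C$ be a vertex coloring, and let $r$ be the vertex cover number of $G$, i.e. the minimal size of a set $S\subseteq V(G)$ meeting every edge. Then the Weisfeiler--Leman dimension of $(G,\chi)$ exists and is at most $\frac{2}{3}r+3$. Here, for $k\ge 1$, the $k$-dimensional Weisfeiler--Leman algorithm ($k$-WL) initially colors each tuple $\bar v\in V(G)^k$ with the isomorphism type of its ordered colored induced subgraph (the colors $\chi(v_i)$, and for which $i,j$ we have $v_i=v_j$ and $v_iv_j\in E(G)$). If $c_i$ is the coloring after $i$ rounds, then $c_{i+1}(\bar v)=(c_i(\bar v),M_i(\bar v))$, where for $k\ge 2$ \[M_i(\bar v)=\{\!\!\{(c_i(\bar v[w/1]),\dots,c_i(\bar v[w/k])) \mid w\in V(G)\}\!\!\},\] $\bar v[w/j]$ being $\bar v$ with its $j$-th entry replaced by $w$, and for $k=1$, $M_i(v)=\{\!\!\{c_i(w)\mid vw\in E(G)\}\!\!\}$. The output is $c_{i_\infty+1}$, where $i_\infty$ is the least $i$ such that $c_i$ and $c_{i+1}$ induce the same partition of $V(G)^k$. The algorithm $k$-WL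 distinguishes two colored graphs if the multisets of colors in its outputs on them differ; it identifies $(G,\chi)$ if it distinguishes $(G,\chi)$ from every finite, non-empty colored graph that is not isomorphic to it by a color-preserving isomorphism. The WL dimension of $(G,\chi)$ is the least $k\ge 1$ such that $k$-WL identifies $(G,\chi)$. -/

import Mathlib

namespace WeisfeilerLeman

universe u v w

/-- The isomorphism type of the ordered colored subgraph induced by a `k`-tuple of vertices:
the colors of the entries, the equalities and the adjacencies between them. -/
@[ext]
structure AtomicType (C : Type w) (k : ℕ) : Type w where
  color : Fin k → C
  eq : Fin k → Fin k → Prop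
  adj : Fin k → Fin k → Prop

/-- The isomorphism type of the ordered subgraph of `(G, χ)` induced by the tuple `x`. -/
def atomicType {V : Type u} {C : Type w} {k : ℕ} (G : SimpleGraph V) (χ : V → C)
    (x : Fin k → V) : AtomicType C k where
  color i := χ (x i)
  eq i j := x i = x j
  adj i j := G.Adj (x i) (x j)

/-- Two tuples have the same atomic type iff there is an isomorphism of the induced colored
graphs that maps the `i`-th entry to the `i`-th entry. -/
theorem atomicType_eq_iff {V : Type u} {W : Type v} {C : Type w} {k : ℕ}
    (G : SimpleGraph V) (χ : V → C) (H : SimpleGraph W) (ψ : W → C)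
    (x : Fin k → V) (y : Fin k → W) :
    atomicType G χ x = atomicType H ψ y ↔
      ∃ φ : G.induce (Set.range x) ≃g H.induce (Set.range y),
        (∀ i, φ ⟨x i, Set.mem_range_self i⟩ = ⟨y i, Set.mem_range_self i⟩) ∧
          ∀ z, ψ (φ z) = χ z := by
  constructor
  · intro h
    have hc : ∀ i, χ (x i) = ψ (y i) := fun i => congrFun (congrArg AtomicType.color h) i
    have he : ∀ i j, x i = x j ↔ y i = y j := fun i j =>
      iff_of_eq (congrFun (congrFun (congrArg AtomicType.eq h) i) j)
    have ha : ∀ i j, G.Adj (x i) (x j) ↔ H.Adj (y i) (y j) := fun i j =>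
      iff_of_eq (congrFun (congrFun (congrArg AtomicType.adj h) i) j)
    have hx : ∀ z : Set.range x, ∃ i, x i = z := fun z => z.2
    have hy : ∀ z : Set.range y, ∃ i, y i = z := fun z => z.2
    choose f hf using hx
    choose g hg using hy
    refine ⟨⟨⟨fun z => ⟨y (f z), Set.mem_range_self _⟩,
      fun z => ⟨x (g z), Set.mem_range_self _⟩, ?_, ?_⟩, ?_⟩, ?_, ?_⟩
    · intro z
      apply Subtype.ext
      exact ((he _ _).2 (hg _)).trans (hf z)
    · intro z
      apply Subtype.ext
      exact ((he _ _).1 (hf _)).trans (hg z)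
    · intro a b
      change H.Adj (y (f a)) (y (f b)) ↔ G.Adj a b
      rw [← ha, hf, hf]
    · intro i
      apply Subtype.ext
      exact (he _ _).1 (hf _)
    · intro z
      change ψ (y (f z)) = χ z
      rw [← hc, hf]
  · rintro ⟨φ, h1, h2⟩
    ext i j
    · have := h2 ⟨x i, Set.mem_range_self i⟩
      rw [h1] at this
      exact this.symm
    · change x i = x j ↔ y i = y j
      have := φ.injective.eq_iff (a := ⟨x i, Set.mem_range_self i⟩)
        (b := ⟨x j, Set.mem_range_self j⟩)
      rw [h1, h1, Subtype.mk.injEq, Subtype.mk.injEq] at this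
      exact this.symm
    · change G.Adj (x i) (x j) ↔ H.Adj (y i) (y j)
      have := φ.map_rel_iff (a := ⟨x i, Set.mem_range_self i⟩)
        (b := ⟨x j, Set.mem_range_self j⟩)
      rw [h1, h1] at this
      exact this.symm

/-- The colors used by the `k`-dimensional algorithm after `i` rounds. -/
def RoundColor (C : Type w) (k : ℕ) : ℕ → Type w
  | 0 => AtomicType C k
  | i + 1 => RoundColor C k i × Multiset (Fin k → RoundColor C k i)

open Classical in
/-- The coloring of `k`-tuples after `i` rounds of `k`-WL on `(G, χ)`. In a round, `x` receives
the multiset, over the vertices `z`, of the tuples of colors of `x[z/1], …, x[z/k]`; here `z`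
ranges over all vertices if `k ≥ 2`, and over the neighbors of the only entry of `x` if `k = 1`. -/
noncomputable def wlRound {V : Type u} [Fintype V] {C : Type w} (k : ℕ) (G : SimpleGraph V)
    (χ : V → C) : (i : ℕ) → (Fin k → V) → RoundColor C k i
  | 0 => atomicType G χ
  | i + 1 => fun x =>
      (wlRound k G χ i x,
        (Finset.univ.filter fun z : V => k = 1 → ∀ j, G.Adj (x j) z).val.map
          fun z j => wlRound k G χ i (Function.update x j z))

/-- `f` refines `g`. -/
def Refines {X : Type u} {A : Type v} {B : Type w} (f : X → A) (g : X → B) : Prop :=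
  ∀ x y, f x = f y → g x = g y

/-- The rounds `i` such that the colorings after `i` and after `i + 1` rounds are equivalent. -/
def stableRounds {V : Type u} [Fintype V] {C : Type w} (k : ℕ) (G : SimpleGraph V)
    (χ : V → C) : Set ℕ :=
  {i | Refines (wlRound k G χ i) (wlRound k G χ (i + 1)) ∧
    Refines (wlRound k G χ (i + 1)) (wlRound k G χ i)}

theorem stableRounds_nonempty {V : Type u} [Fintype V] {C : Type w} (k : ℕ)
    (G : SimpleGraph V) (χ : V → C) : (stableRounds k G χ).Nonempty := by
  by_contra hne
  have hlt : ∀ i, Setoid.ker (wlRound k G χ (i + 1)) < Setoid.ker (wlRound k G χ i) := by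
    intro i
    have hr : Refines (wlRound k G χ (i + 1)) (wlRound k G χ i) :=
      fun x y h => congrArg Prod.fst h
    refine lt_of_le_not_ge (fun x y h => hr x y h) fun h => hne ⟨i, fun x y hxy => h hxy, hr⟩
  have : Finite (Setoid (Fin k → V)) :=
    Finite.of_injective (fun s : Setoid (Fin k → V) => fun a b => s a b)
      fun s t h => Setoid.ext fun a b => iff_of_eq (congrFun (congrFun h a) b)
  exact not_injective_infinite_finite _
    (strictAnti_nat_of_succ_lt (f := fun i => Setoid.ker (wlRound k G χ i)) hlt).injective

/-- The least round after which the coloring is stable. -/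
noncomputable def stableRound {V : Type u} [Fintype V] {C : Type w} (k : ℕ)
    (G : SimpleGraph V) (χ : V → C) : ℕ :=
  sInf (stableRounds k G χ)

/-- The output of `k`-WL on `(G, χ)`: the coloring one round after stabilization. The colors are
tagged with their round, so that colors of different rounds are different. -/
noncomputable def wl {V : Type u} [Fintype V] {C : Type w} (k : ℕ) (G : SimpleGraph V)
    (χ : V → C) (x : Fin k → V) : Σ i, RoundColor C k i :=
  ⟨stableRound k G χ + 1, wlRound k G χ (stableRound k G χ + 1) x⟩

/-- `k`-WL distinguishes `(G, χ)` and `(H, ψ)`: the multisets of colors in the outputs differ. -/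
def Distinguishes {V : Type u} {W : Type v} [Fintype V] [Fintype W] {C : Type w} (k : ℕ)
    (G : SimpleGraph V) (χ : V → C) (H : SimpleGraph W) (ψ : W → C) : Prop :=
  (Finset.univ : Finset (Fin k → V)).val.map (wl k G χ) ≠
    (Finset.univ : Finset (Fin k → W)).val.map (wl k H ψ)

/-- Isomorphism of colored graphs. -/
def Isomorphic {V : Type u} {W : Type v} {C : Type w}
    (G : SimpleGraph V) (χ : V → C) (H : SimpleGraph W) (ψ : W → C) : Prop :=
  ∃ φ : G ≃g H, ∀ x, ψ (φ x) = χ x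

/-- `k`-WL identifies `(G, χ)`: it distinguishes it from every non-isomorphic colored graph. -/
def Identifies {V : Type u} [Fintype V] {C : Type w} (k : ℕ) (G : SimpleGraph V)
    (χ : V → C) : Prop :=
  ∀ (W : Type u) [Fintype W] [Nonempty W] (H : SimpleGraph W) (ψ : W → C),
    ¬ Isomorphic G χ H ψ → Distinguishes k G χ H ψ

/-- `d` is the WL dimension of `(G, χ)`: the least `k ≥ 1` such that `k`-WL identifies it. -/
def IsWLDimension {V : Type u} [Fintype V] {C : Type w} (G : SimpleGraph V) (χ : V → C)
    (d : ℕ) : Prop :=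
  IsLeast {k : ℕ | 1 ≤ k ∧ Identifies k G χ} d

end WeisfeilerLeman

/-!
Fix a minimum vertex cover `S`. Starting from `T = ∅`, individualize one or two further vertices
as long as color refinement then gains at least `3/2` new color classes inside `S` per vertex.
There are at most `|S|` such classes, so this stops with `|T| ≤ 2r/3`, and it remains to show that
three further pebbles suffice.

Once it has stopped, individualizing a vertex `x` splits classes of `S` hardly at all, which leaves
little freedom in the graph. A vertex is homogeneous to all but at most one of the classes inside
`S`, where the neighborhoods of a vertex class in such a class form a trivial design, and the edges
between the remaining classes form disjoint bicliques and monochromatic cliques. Three pebbles see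
the component of each vertex of the latter graph, and the number of neighbors that determines the
rest, so an opponent graph that agrees with `G` in this game is isomorphic to `G`.
-/

namespace WeisfeilerLeman

universe u v w

open Finset
open scoped Classical

section Counting

variable {V : Type u} {W : Type v} {K : Type w}

theorem exists_equiv_of_card_fiber_eq [Fintype V] [Fintype W] {f : V → K} {g : W → K}
    (h : ∀ k, #{x | f x = k} = #{y | g y = k}) : ∃ e : V ≃ W, ∀ x, g (e x) = f x := by
  have fiber : ∀ k, Nonempty ({x // f x = k} ≃ {y // g y = k}) := fun k =>
    ⟨Fintype.equivOfCardEq (by simpa only [Fintype.card_subtype] using h k)⟩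
  exact ⟨Equiv.ofFiberEquiv fun k => (fiber k).some, Equiv.ofFiberEquiv_map _⟩

theorem exists_equiv_of_map_eq [Fintype V] [Fintype W] {f : V → K} {g : W → K}
    (h : univ.val.map f = univ.val.map g) : ∃ e : V ≃ W, ∀ x, g (e x) = f x := by
  refine exists_equiv_of_card_fiber_eq fun k => ?_
  have count := congrArg (Multiset.count k) h
  simpa only [Multiset.count_map, eq_comm (a := k), card_def, filter_val] using count

theorem exists_perm_of_forall_fiber {f : V → K} {Q : V → V → Prop}
    (h : ∀ k, ∃ e : Equiv.Perm {x // f x = k}, ∀ x : {x // f x = k}, Q x (e x)) :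
    ∃ e : Equiv.Perm V, ∀ x, f (e x) = f x ∧ Q x (e x) := by
  choose e he using h
  exact ⟨Equiv.ofFiberEquiv e, fun x => ⟨Equiv.ofFiberEquiv_map e x, he (f x) ⟨x, rfl⟩⟩⟩

theorem iff_of_card_filter_eq {P : Finset V} {A B : V → Prop}
    (hcard : #(P.filter A) = #(P.filter B)) (hAB : ∀ z ∈ P, A z → B z) {z : V} (hz : z ∈ P) :
    A z ↔ B z := by
  have heq : P.filter A = P.filter B :=
    eq_of_subset_of_card_le (fun z hz => by grind) hcard.ge
  simpa only [mem_filter, hz, true_and] using Finset.ext_iff.1 heq z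

end Counting

section Blocks

variable {V : Type u} {W : Type v} {P : Finset V} {D : Finset W} {B : W → V → Prop}

/-- The blocks `B x`, for `x ∈ D`, look the same from any two pairs of distinct points of `P` with
the same first point: every block has a counterpart that meets the second pair in the same way. -/
def PairHomogeneous (P : Finset V) (D : Finset W) (B : W → V → Prop) : Prop :=
  ∀ x ∈ D, ∀ v ∈ P, ∀ a ∈ P, ∀ b ∈ P, a ≠ v → b ≠ v →
    ∃ y ∈ D, (B x v ↔ B y v) ∧ (B x a ↔ B y b)

/-- Two blocks cross if they cut `P` into four nonempty parts. -/
def Crosses (P : Finset V) (A B : V → Prop) : Prop :=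
  (∃ a ∈ P, A a ∧ B a) ∧ (∃ a ∈ P, A a ∧ ¬ B a) ∧ (∃ a ∈ P, ¬ A a ∧ B a) ∧
    ∃ a ∈ P, ¬ A a ∧ ¬ B a

theorem PairHomogeneous.not (h : PairHomogeneous P D B) :
    PairHomogeneous P D fun x v => ¬ B x v := by
  intro x hx v hv a ha b hb hav hbv
  obtain ⟨y, hy, hyv, hyb⟩ := h x hx v hv a ha b hb hav hbv
  exact ⟨y, hy, not_congr hyv, not_congr hyb⟩

theorem crosses_not {A B : V → Prop} :
    Crosses P (fun v => ¬ A v) (fun v => ¬ B v) ↔ Crosses P A B := by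
  simp only [Crosses, not_not]
  tauto

theorem PairHomogeneous.exists_crosses_of_le_half (h : PairHomogeneous P D B) (hD : D.Nonempty)
    {k : ℕ} (hk : ∀ x ∈ D, #(P.filter (B x)) = k) (h2 : 2 ≤ k) (hP : 2 * k ≤ #P) :
    ∃ x ∈ D, ∃ y ∈ D, Crosses P (B x) (B y) := by
  obtain ⟨x, hx⟩ := hD
  obtain ⟨v, hv, u, hu, hvu⟩ := one_lt_card.1 (h2.trans_eq (hk x hx).symm)
  rw [mem_filter] at hv hu
  obtain ⟨w, hw, hxw⟩ : ∃ w ∈ P, ¬ B x w := by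
    by_contra! hall
    have := hk x hx
    rw [filter_true_of_mem hall] at this
    omega
  have hwv : w ≠ v := fun hwv => hxw (hwv ▸ hv.2)
  obtain ⟨y, hy, hyv, hyw⟩ := h x hx v hv.1 u hu.1 w hw hvu.symm hwv
  replace hyv := hyv.1 hv.2
  replace hyw := hyw.1 hu.2
  refine ⟨x, hx, y, hy, ⟨v, hv.1, hv.2, hyv⟩, ?_, ⟨w, hw, hxw, hyw⟩, ?_⟩
  · by_contra! hsub
    exact hxw ((iff_of_card_filter_eq ((hk x hx).trans (hk y hy).symm) hsub hw).2 hyw)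
  · by_contra! hcover
    have hunion : P ⊆ P.filter (B x) ∪ P.filter (B y) := by grind
    have hinter : 0 < #(P.filter (B x) ∩ P.filter (B y)) :=
      card_pos.2 ⟨v, by simp only [mem_inter, mem_filter, hv, hyv, and_self]⟩
    have hle := card_le_card hunion
    have hsum := card_union_add_card_inter (P.filter (B x)) (P.filter (B y))
    rw [hk x hx, hk y hy] at hsum
    omega

theorem PairHomogeneous.exists_crosses (h : PairHomogeneous P D B) (hD : D.Nonempty) {k : ℕ}
    (hk : ∀ x ∈ D, #(P.filter (B x)) = k) (h2 : 2 ≤ k) (hP : k + 2 ≤ #P) :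
    ∃ x ∈ D, ∃ y ∈ D, Crosses P (B x) (B y) := by
  rcases le_total (2 * k) #P with hle | hle
  · exact h.exists_crosses_of_le_half hD hk h2 hle
  · have hcompl : ∀ x ∈ D, #(P.filter fun v => ¬ B x v) = #P - k := fun x hx => by
      have := card_filter_add_card_filter_not (s := P) (B x)
      rw [← hk x hx]
      omega
    obtain ⟨x, hx, y, hy, hxy⟩ := h.not.exists_crosses_of_le_half hD (k := #P - k)
      (by convert hcompl) (by omega) (by omega)
    exact ⟨x, hx, y, hy, crosses_not.1 hxy⟩

variable [Fintype W] {B' : W → V → Prop} {k : ℕ}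

theorem exists_perm_of_card_block_eq_one (hB : ∀ x, #(P.filter (B x)) = 1)
    (hB' : ∀ x, #(P.filter (B' x)) = 1) (hdeg : ∀ p ∈ P, #{x | B x p} = #{x | B' x p}) :
    ∃ e : Equiv.Perm W, ∀ x, ∀ p ∈ P, (B x p ↔ B' (e x) p) := by
  have trace_eq : ∀ {B : W → V → Prop}, (∀ x, #(P.filter (B x)) = 1) → ∀ p ∈ P, ∀ x,
      P.filter (B x) = {p} ↔ B x p := by
    intro B hB p hp x
    obtain ⟨q, hq⟩ := card_eq_one.1 (hB x)
    have hpq : B x p ↔ p = q := by simpa [hp] using Finset.ext_iff.1 hq p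
    rw [hq, singleton_inj, hpq, eq_comm]
  obtain ⟨e, he⟩ := exists_equiv_of_card_fiber_eq (f := fun x => P.filter (B x))
    (g := fun x => P.filter (B' x)) fun A => by
      by_cases hA : ∃ p ∈ P, A = {p}
      · obtain ⟨p, hp, rfl⟩ := hA
        simpa only [trace_eq hB p hp, trace_eq hB' p hp] using hdeg p hp
      · have not_trace : ∀ {B : W → V → Prop}, (∀ x, #(P.filter (B x)) = 1) → ∀ x,
            P.filter (B x) ≠ A := by
          rintro B hB x rfl
          obtain ⟨q, hq⟩ := card_eq_one.1 (hB x)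
          exact hA ⟨q, (mem_filter.1 (hq ▸ mem_singleton_self q)).1, hq⟩
        simp only [not_trace hB, not_trace hB', filter_false]
  refine ⟨e, fun x p hp => ?_⟩
  rw [← trace_eq hB p hp, ← trace_eq hB' p hp, he]

theorem exists_perm_of_card_block_le_one (hB : ∀ x, #(P.filter (B x)) = k)
    (hB' : ∀ x, #(P.filter (B' x)) = k) (hk : k ≤ 1)
    (hdeg : ∀ p ∈ P, #{x | B x p} = #{x | B' x p}) :
    ∃ e : Equiv.Perm W, ∀ x, ∀ p ∈ P, (B x p ↔ B' (e x) p) := by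
  obtain rfl | rfl := Nat.le_one_iff_eq_zero_or_eq_one.1 hk
  · refine ⟨Equiv.refl W, fun x p hp => iff_of_false ?_ ?_⟩
    · exact filter_eq_empty_iff.1 (card_eq_zero.1 (hB x)) hp
    · exact filter_eq_empty_iff.1 (card_eq_zero.1 (hB' x)) hp
  · exact exists_perm_of_card_block_eq_one hB hB' hdeg

theorem exists_perm_of_card_block (hB : ∀ x, #(P.filter (B x)) = k)
    (hB' : ∀ x, #(P.filter (B' x)) = k) (hk : k ≤ 1 ∨ #P ≤ k + 1)
    (hdeg : ∀ p ∈ P, #{x | B x p} = #{x | B' x p}) :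
    ∃ e : Equiv.Perm W, ∀ x, ∀ p ∈ P, (B x p ↔ B' (e x) p) := by
  obtain hk | hk := hk
  · exact exists_perm_of_card_block_le_one hB hB' hk hdeg
  · have card_not : ∀ {B : W → V → Prop}, (∀ x, #(P.filter (B x)) = k) → ∀ x,
        #(P.filter fun p => ¬ B x p) = #P - k := by
      intro B hB x
      have := card_filter_add_card_filter_not (s := P) (B x)
      rw [← hB x]
      omega
    have deg_not : ∀ p ∈ P, #{x | ¬ B x p} = #{x | ¬ B' x p} := by
      intro p hp
      have hsum := card_filter_add_card_filter_not (s := univ) fun x => B x p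
      have hsum' := card_filter_add_card_filter_not (s := univ) fun x => B' x p
      have := hdeg p hp
      omega
    obtain ⟨e, he⟩ := exists_perm_of_card_block_le_one (k := #P - k) (by convert card_not hB)
      (by convert card_not hB') (by omega) (by convert deg_not)
    exact ⟨e, fun x p hp => not_iff_not.1 (he x p hp)⟩

end Blocks

section Refinement

variable {V : Type u} {C : Type v} {G : SimpleGraph V} {χ : V → C}

/-- A bisimulation: a relation that preserves `χ` and comes with a bijection of the vertices that
preserves both the relation and the adjacency to the given pair, that is, an invariant of the
bijective two-pebble game on `(G, χ)`. -/
def IsBisimulation (G : SimpleGraph V) (χ : V → C) (R : V → V → Prop) : Prop :=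
  ∀ v w, R v w → χ v = χ w ∧ ∃ e : V ≃ V, ∀ z, R z (e z) ∧ (G.Adj v z ↔ G.Adj w (e z))

theorem isBisimulation_eq (G : SimpleGraph V) (χ : V → C) : IsBisimulation G χ Eq := by
  rintro v _ rfl
  exact ⟨rfl, Equiv.refl V, fun _ => ⟨rfl, Iff.rfl⟩⟩

theorem IsBisimulation.flip {R : V → V → Prop} (h : IsBisimulation G χ R) :
    IsBisimulation G χ (flip R) := by
  intro w v hvw
  obtain ⟨hχ, e, he⟩ := h v w hvw
  refine ⟨hχ.symm, e.symm, fun z => ?_⟩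
  obtain ⟨hR, hadj⟩ := he (e.symm z)
  rw [e.apply_symm_apply] at hR hadj
  exact ⟨hR, hadj.symm⟩

theorem IsBisimulation.comp {R R' : V → V → Prop} (h : IsBisimulation G χ R)
    (h' : IsBisimulation G χ R') : IsBisimulation G χ (Relation.Comp R R') := by
  rintro v x ⟨w, hvw, hwx⟩
  obtain ⟨hχ, e, he⟩ := h v w hvw
  obtain ⟨hχ', e', he'⟩ := h' w x hwx
  exact ⟨hχ.trans hχ', e.trans e', fun z =>
    ⟨⟨e z, (he z).1, (he' _).1⟩, (he z).2.trans (he' _).2⟩⟩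

/-- Indistinguishability of vertices of `(G, χ)` by color refinement. -/
def bisimilarity (G : SimpleGraph V) (χ : V → C) : Setoid V where
  r v w := ∃ R, IsBisimulation G χ R ∧ R v w
  iseqv :=
    { refl := fun _ => ⟨Eq, isBisimulation_eq G χ, rfl⟩
      symm := fun ⟨_, hR, h⟩ => ⟨_, hR.flip, h⟩
      trans := fun ⟨_, hR, h⟩ ⟨_, hR', h'⟩ => ⟨_, hR.comp hR', _, h, h'⟩ }

/-- The stable coloring that color refinement computes on `(G, χ)`. -/
def stableColor (G : SimpleGraph V) (χ : V → C) : V → Quotient (bisimilarity G χ) :=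
  Quotient.mk _

theorem stableColor_eq_iff {v w : V} :
    stableColor G χ v = stableColor G χ w ↔ ∃ R, IsBisimulation G χ R ∧ R v w :=
  Quotient.eq

theorem refines_stableColor (G : SimpleGraph V) (χ : V → C) : Refines (stableColor G χ) χ := by
  intro v w h
  obtain ⟨R, hR, hvw⟩ := stableColor_eq_iff.1 h
  exact (hR v w hvw).1

/-- A coloring that color refinement cannot refine further. On finite graphs this says that
vertices of the same color have equally many neighbors of each color. -/
def Equitable {K : Type w} (G : SimpleGraph V) (c : V → K) : Prop :=
  ∀ v w, c v = c w → ∃ e : V ≃ V, ∀ z, c (e z) = c z ∧ (G.Adj v z ↔ G.Adj w (e z))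

theorem equitable_stableColor (G : SimpleGraph V) (χ : V → C) :
    Equitable G (stableColor G χ) := by
  intro v w h
  obtain ⟨R, hR, hvw⟩ := stableColor_eq_iff.1 h
  obtain ⟨-, e, he⟩ := hR v w hvw
  exact ⟨e, fun z => ⟨(stableColor_eq_iff.2 ⟨R, hR, (he z).1⟩).symm, (he z).2⟩⟩

theorem refines_stableColor_stableColor {C' : Type w} {χ' : V → C'} (h : Refines χ' χ) :
    Refines (stableColor G χ') (stableColor G χ) := by
  intro v w hvw
  obtain ⟨R, hR, hRvw⟩ := stableColor_eq_iff.1 hvw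
  exact stableColor_eq_iff.2 ⟨R, fun a b hab => ⟨h a b (hR a b hab).1, (hR a b hab).2⟩, hRvw⟩

end Refinement

section Equitable

variable {V : Type u} {K : Type v} {G : SimpleGraph V} {c : V → K} {A B : V → Prop}

/-- `B` is a union of color classes of `c`. -/
def Saturated (c : V → K) (B : V → Prop) : Prop :=
  ∀ v w, c v = c w → (B v ↔ B w)

theorem Saturated.and (hA : Saturated c A) (hB : Saturated c B) :
    Saturated c fun v => A v ∧ B v :=
  fun v w h => and_congr (hA v w h) (hB v w h)

theorem Saturated.not (hA : Saturated c A) : Saturated c fun v => ¬ A v :=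
  fun v w h => not_congr (hA v w h)

theorem saturated_color_eq (c : V → K) (k : K) : Saturated c fun v => c v = k :=
  fun _ _ h => by simp only [h]

theorem Equitable.exists_adj (hc : Equitable G c) {v w z : V} (hvw : c v = c w)
    (hvz : G.Adj v z) : ∃ y, c y = c z ∧ G.Adj w y := by
  obtain ⟨e, he⟩ := hc v w hvw
  exact ⟨e z, (he z).1, (he z).2.1 hvz⟩

/-- The neighbors of `v` that satisfy `B`. -/
noncomputable def nbrs [Fintype V] (G : SimpleGraph V) (v : V) (B : V → Prop) : Finset V :=
  univ.filter fun z => G.Adj v z ∧ B z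

@[simp]
theorem mem_nbrs [Fintype V] {v z : V} : z ∈ nbrs G v B ↔ G.Adj v z ∧ B z := by
  simp only [nbrs, mem_filter, mem_univ, true_and]

theorem Equitable.card_nbrs_eq [Fintype V] (hc : Equitable G c) (hB : Saturated c B) {v w : V}
    (hvw : c v = c w) : #(nbrs G v B) = #(nbrs G w B) := by
  obtain ⟨e, he⟩ := hc v w hvw
  refine card_bijective e e.bijective fun z => ?_
  rw [mem_nbrs, mem_nbrs, (he z).2, hB _ _ (he z).1]

theorem adj_iff_of_card_nbrs_eq [Fintype V] {H : SimpleGraph V} {x y z : V}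
    (hcard : #(nbrs G x B) = #(nbrs H y B)) (h : ∀ a, B a → G.Adj x a → H.Adj y a) (hz : B z) :
    G.Adj x z ↔ H.Adj y z := by
  refine iff_of_card_filter_eq (P := univ.filter B) ?_ (fun a ha => h a (mem_filter.1 ha).2)
    (mem_filter.2 ⟨mem_univ z, hz⟩)
  simpa only [nbrs, filter_filter, and_comm] using hcard

theorem adj_iff_of_card_nbrs_eq_of_forall [Fintype V] {H : SimpleGraph V} {x y z : V}
    (hcard : #(nbrs G x B) = #(nbrs H y B)) (h : ∀ a b, B a → B b → G.Adj x a → G.Adj x b)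
    (hz : B z) : G.Adj x z ↔ H.Adj y z := by
  by_cases hxz : G.Adj x z
  · exact (adj_iff_of_card_nbrs_eq hcard.symm (fun a ha _ => h z a hz ha hxz) hz).symm
  · exact adj_iff_of_card_nbrs_eq hcard (fun a ha hxa => absurd (h a z ha hz hxa) hxz) hz

/-- The color class of `v` lies in `S`. -/
def Inside (c : V → K) (S : Finset V) (v : V) : Prop :=
  ∀ u, c u = c v → u ∈ S

variable {S : Finset V}

theorem Inside.mem {v : V} (h : Inside c S v) : v ∈ S :=
  h v rfl

theorem saturated_inside (c : V → K) (S : Finset V) : Saturated c (Inside c S) :=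
  fun v w h => by simp only [Inside, h]

theorem not_inside_iff {v : V} : ¬ Inside c S v ↔ ∃ u, c u = c v ∧ u ∉ S := by
  simp only [Inside, not_forall, exists_prop]

theorem Saturated.inside (hA : Saturated c A) (hS : ∀ v, A v → v ∈ S) {v : V} (hv : A v) :
    Inside c S v :=
  fun u hu => hS u ((hA u v hu).2 hv)

theorem Inside.mono {K' : Type w} {c' : V → K'} (h : Refines c' c) {v : V}
    (hv : Inside c S v) : Inside c' S v :=
  fun u hu => hv u (h u v hu)

/-- The colors whose color classes are nonempty subsets of `S`. -/
noncomputable def insideColors [Fintype V] (c : V → K) (S : Finset V) : Finset K :=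
  (univ.filter (Inside c S)).image c

theorem mem_insideColors [Fintype V] {k : K} :
    k ∈ insideColors c S ↔ ∃ v, Inside c S v ∧ c v = k := by
  simp only [insideColors, mem_image, mem_filter, mem_univ, true_and]

theorem card_insideColors_le [Fintype V] (c : V → K) (S : Finset V) :
    #(insideColors c S) ≤ #S :=
  (card_le_card (image_subset_image fun _ hv => (mem_filter.1 hv).2.mem)).trans card_image_le

theorem card_insideColors_add_le [Fintype V] {K' : Type w} {c' : V → K'} (h : Refines c' c)
    {n : ℕ} {A : Fin n → V → Prop} (hA : ∀ i, Saturated c' (A i)) (hne : ∀ i, ∃ v, A i v)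
    (hAS : ∀ i v, A i v → v ∈ S) (hdisj : ∀ i j v, A i v → A j v → i = j)
    (huncovered : ∀ p, Inside c S p → ∃ p', c p' = c p ∧ ∀ i, ¬ A i p') :
    #(insideColors c S) + n ≤ #(insideColors c' S) := by
  choose q hq using hne
  have hinj : Function.Injective fun i => c' (q i) := fun i j hij =>
    hdisj i j (q i) (hq i) ((hA j _ _ hij).2 (hq j))
  have hsub : univ.image (fun i => c' (q i)) ⊆ insideColors c' S := by
    intro k hk
    obtain ⟨i, -, rfl⟩ := mem_image.1 hk
    exact mem_insideColors.2 ⟨q i, (hA i).inside (hAS i) (hq i), rfl⟩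
  have hle : #(insideColors c S) ≤ #(insideColors c' S \ univ.image fun i => c' (q i)) := by
    refine card_le_card_of_forall_subsingleton (fun k k' => ∃ v, c v = k ∧ c' v = k') ?_ ?_
    · intro k hk
      obtain ⟨p, hp, rfl⟩ := mem_insideColors.1 hk
      obtain ⟨p', hp', hAp'⟩ := huncovered p hp
      refine ⟨c' p', mem_sdiff.2 ⟨mem_insideColors.2 ⟨p', ?_, rfl⟩, ?_⟩, p', hp', rfl⟩
      · exact ((saturated_inside c S _ _ hp').2 hp).mono h
      · intro hk
        obtain ⟨i, -, hi⟩ := mem_image.1 hk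
        exact hAp' i ((hA i _ _ hi).1 (hq i))
    · rintro k' - k₁ ⟨-, v₁, rfl, hv₁⟩ k₂ ⟨-, v₂, rfl, hv₂⟩
      exact h v₁ v₂ (hv₁.trans hv₂.symm)
  rw [card_sdiff_of_subset hsub, card_image_of_injective _ hinj, card_univ,
    Fintype.card_fin] at hle
  have := card_le_card hsub
  rw [card_image_of_injective _ hinj, card_univ, Fintype.card_fin] at this
  omega

end Equitable

section Individualization

variable {V : Type u} {C : Type v} {G : SimpleGraph V} {χ : V → C} {T T' : Finset V}

/-- The coloring `χ` in which each vertex of `T` receives a private color. -/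
noncomputable def individualize (χ : V → C) (T : Finset V) (v : V) : C × Finset V :=
  (χ v, T ∩ {v})

theorem individualize_eq_iff {v w : V} :
    individualize χ T v = individualize χ T w ↔ χ v = χ w ∧ ∀ t ∈ T, (v = t ↔ w = t) := by
  simp only [individualize, Prod.mk.injEq, Finset.ext_iff, mem_inter, mem_singleton,
    and_congr_right_iff, eq_comm]

/-- The color refinement coloring of `(G, χ)` after the individualization of `T`. -/
noncomputable def pinColor (G : SimpleGraph V) (χ : V → C) (T : Finset V) :
    V → Quotient (bisimilarity G (individualize χ T)) :=
  stableColor G (individualize χ T)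

theorem equitable_pinColor (G : SimpleGraph V) (χ : V → C) (T : Finset V) :
    Equitable G (pinColor G χ T) :=
  equitable_stableColor G _

theorem refines_pinColor (hT : T ⊆ T') : Refines (pinColor G χ T') (pinColor G χ T) := by
  refine refines_stableColor_stableColor fun v w h => ?_
  rw [individualize_eq_iff] at h ⊢
  exact ⟨h.1, fun t ht => h.2 t (hT ht)⟩

theorem eq_of_pinColor_eq {v t : V} (ht : t ∈ T) (h : pinColor G χ T v = pinColor G χ T t) :
    v = t :=
  ((individualize_eq_iff.1 (refines_stableColor G _ v t h)).2 t ht).2 rfl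

theorem saturated_pinColor_eq (hT : T ⊆ T') (p : V) :
    Saturated (pinColor G χ T') fun v => pinColor G χ T v = pinColor G χ T p :=
  fun v w h => by simp only [refines_pinColor hT v w h]

theorem saturated_eq {t : V} (ht : t ∈ T) : Saturated (pinColor G χ T) fun v => v = t := by
  intro v w h
  constructor <;> rintro rfl
  · exact eq_of_pinColor_eq ht h.symm
  · exact eq_of_pinColor_eq ht h

theorem saturated_adj {t : V} (ht : t ∈ T) : Saturated (pinColor G χ T) (G.Adj t) := by
  intro v w h
  obtain ⟨e, he⟩ := equitable_pinColor G χ T v w h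
  have hadj := (he t).2
  rwa [eq_of_pinColor_eq ht (he t).1, G.adj_comm, G.adj_comm w] at hadj

end Individualization

section Stuck

variable {V : Type u} [Fintype V] {C : Type v} {G : SimpleGraph V} {χ : V → C}
  {S T : Finset V}

/-- `S` is a vertex cover, and individualizing one or two more vertices in addition to `T` does
not produce more new color classes inside `S` than it individualizes vertices. -/
structure Stuck (G : SimpleGraph V) (χ : V → C) (S T : Finset V) : Prop where
  cover : ∀ u v, G.Adj u v → u ∉ S → v ∈ S
  gain : ∀ T', T ⊆ T' → #T' ≤ #T + 2 →
    #(insideColors (pinColor G χ T') S) + #T ≤ #(insideColors (pinColor G χ T) S) + #T'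

theorem Stuck.exists_covered (h : Stuck G χ S T) {T' : Finset V} (hT : T ⊆ T') {n : ℕ}
    (hcard : #T' < #T + n) (hn : n ≤ 3) {A : Fin n → V → Prop}
    (hA : ∀ i, Saturated (pinColor G χ T') (A i)) (hne : ∀ i, ∃ v, A i v)
    (hAS : ∀ i v, A i v → v ∈ S) (hdisj : ∀ i j v, A i v → A j v → i = j) :
    ∃ p, Inside (pinColor G χ T) S p ∧
      ∀ p', pinColor G χ T p' = pinColor G χ T p → ∃ i, A i p' := by
  by_contra! hcon
  have hge := card_insideColors_add_le (refines_pinColor hT) hA hne hAS hdisj hcon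
  have hle := h.gain T' hT (by omega)
  omega

theorem Stuck.exists_covered_two (h : Stuck G χ S T) {x : V} {A B : V → Prop}
    (hA : Saturated (pinColor G χ (insert x T)) A) (hB : Saturated (pinColor G χ (insert x T)) B)
    (hAne : ∃ v, A v) (hBne : ∃ v, B v) (hAS : ∀ v, A v → v ∈ S) (hBS : ∀ v, B v → v ∈ S)
    (hAB : ∀ v, A v → ¬ B v) :
    ∃ p, Inside (pinColor G χ T) S p ∧
      ∀ p', pinColor G χ T p' = pinColor G χ T p → A p' ∨ B p' := by
  have hdisj : ∀ i j v, ![A, B] i v → ![A, B] j v → i = j := by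
    simp only [Fin.forall_fin_two, Matrix.cons_val_zero, Matrix.cons_val_one]
    grind
  simpa [Fin.exists_fin_two] using h.exists_covered (subset_insert x T) (n := 2)
    (A := ![A, B]) (by have := card_insert_le x T; omega) (by omega)
    (by simp [Fin.forall_fin_two, hA, hB]) (by simp [Fin.forall_fin_two, hAne, hBne])
    (by simpa [Fin.forall_fin_two] using ⟨hAS, hBS⟩) hdisj

theorem Stuck.exists_covered_cells (h : Stuck G χ S T) {x y p : V}
    (hcell : ∀ v, pinColor G χ T v = pinColor G χ T p → G.Adj x v ∨ G.Adj y v → v ∈ S)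
    (hxy : ∃ v, pinColor G χ T v = pinColor G χ T p ∧ G.Adj x v ∧ G.Adj y v)
    (hx : ∃ v, pinColor G χ T v = pinColor G χ T p ∧ G.Adj x v ∧ ¬ G.Adj y v)
    (hy : ∃ v, pinColor G χ T v = pinColor G χ T p ∧ ¬ G.Adj x v ∧ G.Adj y v) :
    Inside (pinColor G χ T) S p ∧
      ∀ v, pinColor G χ T v = pinColor G χ T p → G.Adj x v ∨ G.Adj y v := by
  have hT : T ⊆ insert x (insert y T) := (subset_insert y T).trans (subset_insert x _)
  have hX := saturated_adj (G := G) (χ := χ) (mem_insert_self x (insert y T))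
  have hY := saturated_adj (G := G) (χ := χ) (mem_insert_of_mem (b := x) (mem_insert_self y T))
  have hcl := saturated_pinColor_eq (G := G) (χ := χ) hT p
  set K := fun v => pinColor G χ T v = pinColor G χ T p
  obtain ⟨q, hq, hcov⟩ := h.exists_covered hT (n := 3)
    (A := ![fun v => K v ∧ G.Adj x v ∧ G.Adj y v, fun v => K v ∧ G.Adj x v ∧ ¬ G.Adj y v,
      fun v => K v ∧ ¬ G.Adj x v ∧ G.Adj y v])
    (by have := card_insert_le x (insert y T); have := card_insert_le y T; omega) le_rfl
    (by simpa [Fin.forall_fin_succ] using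
      ⟨hcl.and (hX.and hY), hcl.and (hX.and hY.not), hcl.and (hX.not.and hY)⟩)
    (by simpa [Fin.forall_fin_succ] using ⟨hxy, hx, hy⟩)
    (by simp [Fin.forall_fin_succ]; grind)
    (by simp [Fin.forall_fin_succ]; grind)
  replace hcov : ∀ v, pinColor G χ T v = pinColor G χ T q → K v ∧ (G.Adj x v ∨ G.Adj y v) := by
    intro v hv
    have := hcov v hv
    simp [Fin.exists_fin_succ] at this
    tauto
  have hqp : pinColor G χ T q = pinColor G χ T p := (hcov q rfl).1
  exact ⟨(saturated_inside _ S _ _ hqp).1 hq, fun v hv => (hcov v (hv.trans hqp.symm)).2⟩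

end Stuck

section InsideClasses

variable {V : Type u} [Fintype V] {C : Type v} {G : SimpleGraph V} {χ : V → C}
  {S T : Finset V}

theorem Stuck.adj_of_split (h : Stuck G χ S T) {p q : V} (hp : Inside (pinColor G χ T) S p)
    (hq : Inside (pinColor G χ T) S q) (hpq : pinColor G χ T p ≠ pinColor G χ T q)
    {x a b c d : V} (ha : pinColor G χ T a = pinColor G χ T p)
    (hb : pinColor G χ T b = pinColor G χ T p) (hc : pinColor G χ T c = pinColor G χ T q)
    (hd : pinColor G χ T d = pinColor G χ T q) (hxa : G.Adj x a) (hxb : ¬ G.Adj x b)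
    (hxc : G.Adj x c) : G.Adj x d := by
  have hx := saturated_adj (G := G) (χ := χ) (mem_insert_self x T)
  have hcl := saturated_pinColor_eq (G := G) (χ := χ) (subset_insert x T)
  obtain ⟨z, -, hz⟩ := h.exists_covered_two (hx.and (hcl p)) (hx.and (hcl q)) ⟨a, hxa, ha⟩
    ⟨c, hxc, hc⟩ (fun v hv => hp v hv.2) (fun v hv => hq v hv.2)
    fun v hv hv' => hpq (hv.2.symm.trans hv'.2)
  rcases hz z rfl with hzp | hzq
  · rcases hz b (hb.trans hzp.2.symm) with hb | hb <;> exact absurd hb.1 hxb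
  · rcases hz d (hd.trans hzq.2.symm) with hd | hd <;> exact hd.1

theorem Stuck.adj_of_inside (h : Stuck G χ S T) {v p a b : V}
    (hv : Inside (pinColor G χ T) S v) (hp : Inside (pinColor G χ T) S p)
    (hvp : pinColor G χ T v ≠ pinColor G χ T p) (ha : pinColor G χ T a = pinColor G χ T p)
    (hb : pinColor G χ T b = pinColor G χ T p) (hva : G.Adj v a) : G.Adj v b := by
  by_cases hs : ∃ w, pinColor G χ T w = pinColor G χ T v ∧ w ≠ v
  · obtain ⟨w, hwv, hne⟩ := hs
    have hx := saturated_adj (G := G) (χ := χ) (mem_insert_self v T)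
    have hcl := saturated_pinColor_eq (G := G) (χ := χ) (subset_insert v T)
    obtain ⟨z, -, hz⟩ := h.exists_covered_two (saturated_eq (mem_insert_self v T))
      (hx.and (hcl p)) ⟨v, rfl⟩ ⟨a, hva, ha⟩ (fun u hu => hu ▸ hv.mem) (fun u hu => hp u hu.2)
      (fun u hu hu' => hvp (hu ▸ hu'.2))
    rcases hz z rfl with rfl | hzp
    · rcases hz w hwv with hw | hw
      · exact absurd hw hne
      · exact absurd (hwv.symm.trans hw.2) hvp
    · rcases hz b (hb.trans hzp.2.symm) with rfl | hb'
      · exact absurd hb hvp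
      · exact hb'.1
  · push Not at hs
    obtain ⟨e, he⟩ := equitable_pinColor G χ T a b (ha.trans hb.symm)
    have hadj := (he v).2
    rw [hs _ (he v).1] at hadj
    exact (hadj.1 hva.symm).symm

theorem Stuck.pinColor_insert_eq (h : Stuck G χ S T) {v a b : V}
    (hv : Inside (pinColor G χ T) S v) (ha : pinColor G χ T a = pinColor G χ T v)
    (hb : pinColor G χ T b = pinColor G χ T v) (hav : a ≠ v) (hbv : b ≠ v) :
    pinColor G χ (insert v T) a = pinColor G χ (insert v T) b := by
  have hsub := refines_pinColor (G := G) (χ := χ) (subset_insert v T)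
  obtain ⟨z, -, hz⟩ := h.exists_covered_two (saturated_eq (mem_insert_self v T))
    (saturated_pinColor_eq (Subset.refl _) a) ⟨v, rfl⟩ ⟨a, rfl⟩ (fun u hu => hu ▸ hv.mem)
    (fun u hu => hv u ((hsub u a hu).trans ha))
    (fun u hu hu' => hav (eq_of_pinColor_eq (mem_insert_self _ _) (hu ▸ hu'.symm)))
  have hzv : pinColor G χ T z = pinColor G χ T v := by
    rcases hz z rfl with rfl | hza
    · rfl
    · exact (hsub z a hza).trans ha
  exact ((hz b (hb.trans hzv.symm)).resolve_left hbv).symm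

theorem Stuck.adj_iff_of_pinColor_eq (h : Stuck G χ S T) {v a b : V}
    (hv : Inside (pinColor G χ T) S v) (ha : pinColor G χ T a = pinColor G χ T v)
    (hb : pinColor G χ T b = pinColor G χ T v) (hav : a ≠ v) (hbv : b ≠ v) :
    G.Adj v a ↔ G.Adj v b :=
  saturated_adj (mem_insert_self v T) a b (h.pinColor_insert_eq hv ha hb hav hbv)

theorem Stuck.not_crosses (h : Stuck G χ S T) {p : V} (hp : Inside (pinColor G χ T) S p)
    (x y : V) :
    ¬ Crosses (univ.filter fun z => pinColor G χ T z = pinColor G χ T p) (G.Adj x) (G.Adj y) := by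
  simp only [Crosses, mem_filter, mem_univ, true_and]
  rintro ⟨hxy, hx, hy, d, hd, hxd, hyd⟩
  rcases (h.exists_covered_cells (fun v hv _ => hp v hv) hxy hx hy).2 d hd with hd | hd
  · exact hxd hd
  · exact hyd hd

theorem Stuck.pairHomogeneous (h : Stuck G χ S T) {p : V} (hp : Inside (pinColor G χ T) S p)
    (x : V) : PairHomogeneous (univ.filter fun z => pinColor G χ T z = pinColor G χ T p)
      (univ.filter fun y => pinColor G χ T y = pinColor G χ T x) G.Adj := by
  simp only [PairHomogeneous, mem_filter, mem_univ, true_and]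
  intro y hy v hv a ha b hb hav hbv
  obtain ⟨e, he⟩ := equitable_pinColor G χ (insert v T) a b (h.pinColor_insert_eq
    ((saturated_inside _ S _ _ hv).2 hp) (ha.trans hv.symm) (hb.trans hv.symm) hav hbv)
  refine ⟨e y, (refines_pinColor (subset_insert v T) _ _ (he y).1).trans hy, ?_, ?_⟩
  · rw [G.adj_comm y, G.adj_comm (e y)]
    exact (saturated_adj (mem_insert_self v T) _ _ (he y).1).symm
  · rw [G.adj_comm y, G.adj_comm (e y)]
    exact (he y).2

theorem Stuck.card_block (h : Stuck G χ S T) {p : V} (hp : Inside (pinColor G χ T) S p)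
    (x : V) : #(nbrs G x fun z => pinColor G χ T z = pinColor G χ T p) ≤ 1 ∨
      #{z | pinColor G χ T z = pinColor G χ T p} ≤
        #(nbrs G x fun z => pinColor G χ T z = pinColor G χ T p) + 1 := by
  have hk : ∀ y ∈ univ.filter fun y => pinColor G χ T y = pinColor G χ T x,
      #((univ.filter fun z => pinColor G χ T z = pinColor G χ T p).filter (G.Adj y)) =
        #(nbrs G x fun z => pinColor G χ T z = pinColor G χ T p) := by
    intro y hy
    rw [← (equitable_pinColor G χ T).card_nbrs_eq (saturated_color_eq _ _) (mem_filter.1 hy).2,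
      nbrs, filter_filter]
    simp only [and_comm]
  by_contra! hcon
  obtain ⟨x, -, y, -, hxy⟩ := (h.pairHomogeneous hp x).exists_crosses
    ⟨x, mem_filter.2 ⟨mem_univ x, rfl⟩⟩ hk hcon.1 (by omega)
  exact h.not_crosses hp x y hxy

end InsideClasses

section OuterGraph

variable {V : Type u} {K : Type v}

/-- The subgraph of `G` formed by the edges between color classes that are not contained
in `S`. -/
def outer (G : SimpleGraph V) (c : V → K) (S : Finset V) : SimpleGraph V where
  Adj v w := G.Adj v w ∧ ¬ Inside c S v ∧ ¬ Inside c S w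
  symm := ⟨fun _ _ h => ⟨h.1.symm, h.2.2, h.2.1⟩⟩
  loopless := ⟨fun _ h => G.irrefl h.1⟩

/-- Every vertex that has a neighbor in common with `v` has the same neighbors as `v`: the
connected component of `v` is complete bipartite. -/
def InBiclique (O : SimpleGraph V) (v : V) : Prop :=
  ∀ y z, O.Adj v y → O.Adj z y → ∀ w, O.Adj v w ↔ O.Adj z w

/-- The connected component of `v` is a monochromatic clique. -/
def InClique (O : SimpleGraph V) (c : V → K) (v : V) : Prop :=
  ∀ z, O.Adj v z → c z = c v ∧ ∀ w, w ≠ v → w ≠ z → (O.Adj v w ↔ O.Adj z w)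

theorem InBiclique.of_adj {O : SimpleGraph V} {v w : V} (h : InBiclique O v) (hvw : O.Adj v w) :
    InBiclique O w := by
  intro y z hwy hzy
  have hvz : O.Adj v z := (h w y hvw hwy.symm z).2 hzy.symm
  exact fun u => ⟨fun hwu => ((h w u hvw hwu.symm z).1 hvz).symm,
    fun hzu => ((h z u hvz hzu.symm w).1 hvw).symm⟩

theorem InClique.of_adj {O : SimpleGraph V} {c : V → K} {v w : V} (h : InClique O c v)
    (hvw : O.Adj v w) : InClique O c w := by
  intro z hwz
  by_cases hzv : z = v
  · subst hzv
    exact ⟨(h w hvw).1.symm, fun u huw huz => ((h w hvw).2 u huz huw).symm⟩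
  · have hvz : O.Adj v z := ((h w hvw).2 z hzv hwz.ne').2 hwz
    refine ⟨(h z hvz).1.trans (h w hvw).1.symm, fun u huw huz => ?_⟩
    by_cases huv : u = v
    · subst huv
      exact iff_of_true hvw.symm hvz.symm
    · exact ((h w hvw).2 u huv huw).symm.trans ((h z hvz).2 u huv huz)

theorem Equitable.outer {G : SimpleGraph V} {c : V → K} (hc : Equitable G c) (S : Finset V) :
    Equitable (outer G c S) c := by
  intro v w hvw
  obtain ⟨e, he⟩ := hc v w hvw
  refine ⟨e, fun z => ⟨(he z).1, ?_⟩⟩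
  exact and_congr (he z).2 (and_congr (saturated_inside c S v w hvw).not
    (saturated_inside c S (e z) z (he z).1).symm.not)

theorem Equitable.saturated_exists {G : SimpleGraph V} {c : V → K} (hc : Equitable G c)
    {B : V → Prop} (hB : Saturated c B) (Q : Prop → Prop) :
    Saturated c fun v => ∃ z, B z ∧ Q (G.Adj v z) := by
  intro v w hvw
  obtain ⟨e, he⟩ := hc v w hvw
  exact e.exists_congr fun z => by rw [(he z).2, hB _ _ (he z).1]

theorem Equitable.adj_iff_of_imp [Finite V] {G : SimpleGraph V} {c : V → K}
    (hc : Equitable G c) {v w : V} (hvw : c v = c w) (h : ∀ z, G.Adj v z → G.Adj w z) (z : V) :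
    G.Adj v z ↔ G.Adj w z :=
  have := Fintype.ofFinite V
  adj_iff_of_card_nbrs_eq (B := fun _ => True)
    (hc.card_nbrs_eq (fun _ _ _ => Iff.rfl) hvw) (fun z _ => h z) trivial

theorem Equitable.adj_iff_of_adj_of_imp [Finite V] {G : SimpleGraph V} {c : V → K}
    (hc : Equitable G c) {v w : V} (hvw : c v = c w) (hadj : G.Adj v w)
    (h : ∀ z, z ≠ w → G.Adj v z → G.Adj w z) {z : V} (hzv : z ≠ v) (hzw : z ≠ w) :
    G.Adj v z ↔ G.Adj w z := by
  have := Fintype.ofFinite V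
  have hcard : ∀ a b, G.Adj a b →
      #(nbrs G a fun z => z ≠ a ∧ z ≠ b) + 1 = #(nbrs G a fun _ => True) := by
    intro a b hab
    rw [← card_erase_add_one ((mem_nbrs (B := fun _ => True)).2 ⟨hab, trivial⟩)]
    congr 2
    ext z
    simp only [mem_nbrs, mem_erase, and_true]
    exact ⟨fun hz => ⟨hz.2.2, hz.1⟩, fun hz => ⟨hz.2, hz.2.ne.symm, hz.1⟩⟩
  refine adj_iff_of_card_nbrs_eq (B := fun z => z ≠ v ∧ z ≠ w) ?_ (fun a ha => h a ha.2)
    ⟨hzv, hzw⟩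
  have hv := hcard v w hadj
  have hw := hcard w v hadj.symm
  have hvw := hc.card_nbrs_eq (fun _ _ _ => Iff.rfl) hvw (B := fun _ => True)
  simp only [and_comm (a := _ ≠ w)] at hw
  omega

theorem saturated_outer_adj {C : Type w} {G : SimpleGraph V} {χ : V → C} {S T : Finset V} {x : V} :
    Saturated (pinColor G χ (insert x T)) ((outer G (pinColor G χ T) S).Adj x) := by
  intro v w hvw
  exact and_congr (saturated_adj (mem_insert_self x T) v w hvw) (and_congr_right' (not_congr
    (saturated_inside _ S v w (refines_pinColor (subset_insert x T) v w hvw))))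

end OuterGraph

section OuterEdges

variable {V : Type u} [Fintype V] {C : Type v} {G : SimpleGraph V} {χ : V → C}
  {S T : Finset V}

theorem Stuck.pinColor_eq_of_outer_adj (h : Stuck G χ S T) {v y z : V}
    (hvy : (outer G (pinColor G χ T) S).Adj v y) (hvz : (outer G (pinColor G χ T) S).Adj v z) :
    pinColor G χ T y = pinColor G χ T z := by
  obtain ⟨x, hxv, hx⟩ := not_inside_iff.1 hvy.2.1
  obtain ⟨a, ha, hxa⟩ := (equitable_pinColor G χ T).exists_adj hxv.symm hvy.1
  obtain ⟨b, hb, hxb⟩ := (equitable_pinColor G χ T).exists_adj hxv.symm hvz.1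
  by_contra hyz
  have hadj := saturated_adj (G := G) (χ := χ) (mem_insert_self x T)
  have hcl := saturated_pinColor_eq (G := G) (χ := χ) (subset_insert x T)
  obtain ⟨p, hp, hcov⟩ := h.exists_covered_two (hadj.and (hcl y)) (hadj.and (hcl z))
    ⟨a, hxa, ha⟩ ⟨b, hxb, hb⟩ (fun u hu => h.cover x u hu.1 hx) (fun u hu => h.cover x u hu.1 hx)
    fun u hu hu' => hyz (hu.2.symm.trans hu'.2)
  rcases hcov p rfl with ⟨-, hpy⟩ | ⟨-, hpz⟩
  · exact hvy.2.2 ((saturated_inside _ S _ _ hpy).1 hp)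
  · exact hvz.2.2 ((saturated_inside _ S _ _ hpz).1 hp)

theorem Stuck.adj_of_outer_adj (h : Stuck G χ S T) {v y p a b : V}
    (hvy : (outer G (pinColor G χ T) S).Adj v y) (hp : Inside (pinColor G χ T) S p)
    (ha : pinColor G χ T a = pinColor G χ T p) (hb : pinColor G χ T b = pinColor G χ T p)
    (hva : G.Adj v a) : G.Adj v b := by
  obtain ⟨x, hxv, hx⟩ := not_inside_iff.1 hvy.2.1
  obtain ⟨y', hy', hxy⟩ := (equitable_pinColor G χ T).exists_adj hxv.symm hvy.1
  obtain ⟨a', ha', hxa⟩ := (equitable_pinColor G χ T).exists_adj hxv.symm hva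
  have hadj := saturated_adj (G := G) (χ := χ) (mem_insert_self x T)
  have hcl := saturated_pinColor_eq (G := G) (χ := χ) (subset_insert x T)
  have hyp : pinColor G χ T y ≠ pinColor G χ T p := fun hyp =>
    hvy.2.2 ((saturated_inside _ S _ _ hyp).2 hp)
  obtain ⟨q, hq, hcov⟩ := h.exists_covered_two (hadj.and (hcl y)) (hadj.and (hcl p))
    ⟨y', hxy, hy'⟩ ⟨a', hxa, ha'.trans ha⟩ (fun u hu => h.cover x u hu.1 hx)
    (fun u hu => h.cover x u hu.1 hx) fun u hu hu' => hyp (hu.2.symm.trans hu'.2)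
  have hqp : pinColor G χ T q = pinColor G χ T p := (hcov q rfl).elim
    (fun hqy => absurd ((saturated_inside _ S _ _ hqy.2).1 hq) hvy.2.2) fun hqp => hqp.2
  have hall : ∀ z, pinColor G χ T z = pinColor G χ T p → G.Adj x z := fun z hz =>
    (hcov z (hz.trans hqp.symm)).elim (·.1) (·.1)
  exact (adj_iff_of_card_nbrs_eq ((equitable_pinColor G χ T).card_nbrs_eq
    (saturated_color_eq _ _) hxv.symm) (fun z hz _ => hall z hz) hb).2 (hall b hb)

theorem Stuck.outer_adj_iff_of_notMem (h : Stuck G χ S T) {x w a : V} (hx : x ∉ S) (hw : w ∉ S)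
    (hwx : pinColor G χ T w = pinColor G χ T x) (hxa : (outer G (pinColor G χ T) S).Adj x a)
    (hwa : (outer G (pinColor G χ T) S).Adj w a) (z : V) :
    (outer G (pinColor G χ T) S).Adj x z ↔ (outer G (pinColor G χ T) S).Adj w z := by
  have hO := (equitable_pinColor G χ T).outer S
  by_contra hcon
  obtain ⟨b, hxb, hwb⟩ : ∃ b, (outer G (pinColor G χ T) S).Adj x b ∧
      ¬ (outer G (pinColor G χ T) S).Adj w b := by
    by_contra! hsub
    exact hcon (hO.adj_iff_of_imp hwx.symm hsub z)
  obtain ⟨d, hwd, hxd⟩ : ∃ d, (outer G (pinColor G χ T) S).Adj w d ∧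
      ¬ (outer G (pinColor G χ T) S).Adj x d := by
    by_contra! hsub
    exact hcon (hO.adj_iff_of_imp hwx hsub z).symm
  exact hxa.2.2 (h.exists_covered_cells
    (fun v _ hv => hv.elim (h.cover x v · hx) (h.cover w v · hw)) ⟨a, rfl, hxa.1, hwa.1⟩
    ⟨b, h.pinColor_eq_of_outer_adj hxb hxa, hxb.1, fun hadj => hwb ⟨hadj, hwa.2.1, hxb.2.2⟩⟩
    ⟨d, h.pinColor_eq_of_outer_adj hwd hwa, fun hadj => hxd ⟨hadj, hxa.2.1, hwd.2.2⟩, hwd.1⟩).1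

theorem Stuck.outer_adj_iff_of_not_adj (h : Stuck G χ S T) {x w a : V} (hx : x ∉ S)
    (hwx : pinColor G χ T w = pinColor G χ T x) (hxa : (outer G (pinColor G χ T) S).Adj x a)
    (hwa : (outer G (pinColor G χ T) S).Adj w a) (hxw : ¬ (outer G (pinColor G χ T) S).Adj x w)
    (z : V) : (outer G (pinColor G χ T) S).Adj x z ↔ (outer G (pinColor G χ T) S).Adj w z := by
  by_contra hcon
  obtain ⟨b, hxb, hwb⟩ : ∃ b, (outer G (pinColor G χ T) S).Adj x b ∧
      ¬ (outer G (pinColor G χ T) S).Adj w b := by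
    by_contra! hsub
    exact hcon (((equitable_pinColor G χ T).outer S).adj_iff_of_imp hwx.symm hsub z)
  have hin : ∀ {v}, pinColor G χ T v = pinColor G χ T x → ¬ Inside (pinColor G χ T) S v :=
    fun hv hvS => hxa.2.1 ((saturated_inside _ S _ _ hv).1 hvS)
  set U : V → Prop := (outer G (pinColor G χ T) S).Adj x
  have hUsat : Saturated (pinColor G χ (insert x T)) U := saturated_outer_adj
  have hc := equitable_pinColor G χ (insert x T)
  -- The second class consists of vertices outside `U` that distinguish vertices of `U`, so they
  -- lie in the cover.
  obtain ⟨p, hp, hcov⟩ := h.exists_covered_two hUsat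
    ((saturated_pinColor_eq (subset_insert x T) x).and (hUsat.not.and
      ((hc.saturated_exists hUsat id).and (hc.saturated_exists hUsat Not))))
    ⟨a, hxa⟩ ⟨w, hwx, hxw, ⟨a, hxa, hwa.1⟩, b, hxb, fun hadj => hwb ⟨hadj, hwa.2.1, hxb.2.2⟩⟩
    (fun u hu => h.cover x u hu.1 hx) (fun v ⟨hvx, _, ⟨u, hu, hvu⟩, u', hu', hvu'⟩ => by
      by_contra hv
      exact hvu' ((h.outer_adj_iff_of_notMem hx hv hvx hu ⟨hvu, hin hvx, hu.2.2⟩ u').1 hu').1)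
    (fun u hu hu' => hu'.2.1 hu)
  rcases hcov p rfl with hpU | hpx
  · exact hpU.2.2 hp
  · exact hin hpx.1 hp

theorem Stuck.exists_outer_adj_notMem (h : Stuck G χ S T) {v y : V} (hvS : v ∈ S)
    (hvy : (outer G (pinColor G χ T) S).Adj v y) :
    ∃ z, (outer G (pinColor G χ T) S).Adj v z ∧ z ∉ S := by
  by_contra! hcon
  obtain ⟨p, hp, hcov⟩ := h.exists_covered_two (saturated_eq (mem_insert_self v T))
    saturated_outer_adj ⟨v, rfl⟩ ⟨y, hvy⟩ (fun u hu => hu ▸ hvS) hcon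
    (fun u hu hu' => hu'.ne hu.symm)
  rcases hcov p rfl with rfl | hvp
  · exact hvy.2.1 hp
  · exact hvp.2.2 hp

theorem Stuck.outer_adj_of_common_nbr (h : Stuck G χ S T) {x a b d : V} (hx : x ∉ S)
    (hxa : (outer G (pinColor G χ T) S).Adj x a) (hxb : (outer G (pinColor G χ T) S).Adj x b)
    (hxd : (outer G (pinColor G χ T) S).Adj x d) (hda : d ≠ a)
    (hab : (outer G (pinColor G χ T) S).Adj a b) : (outer G (pinColor G χ T) S).Adj a d := by
  refine ⟨?_, hxa.2.2, hxd.2.2⟩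
  by_contra had
  set O := outer G (pinColor G χ T) S
  have haT : a ∈ insert x (insert a T) := mem_insert_of_mem (mem_insert_self a T)
  have hT : T ⊆ insert x (insert a T) := (subset_insert a T).trans (subset_insert x _)
  have hA := saturated_adj (G := G) (χ := χ) haT
  have hE := saturated_eq (G := G) (χ := χ) haT
  have hX : Saturated (pinColor G χ (insert x (insert a T))) (O.Adj x) := fun v w hvw =>
    saturated_outer_adj v w (refines_pinColor (insert_subset_insert x (subset_insert a T)) v w hvw)
  obtain ⟨p, hp, hcov⟩ := h.exists_covered hT (n := 3)
    (A := ![fun v => v = a, fun v => O.Adj x v ∧ G.Adj a v,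
      fun v => O.Adj x v ∧ ¬ G.Adj a v ∧ ¬ v = a])
    (by have := card_insert_le x (insert a T); have := card_insert_le a T; omega) le_rfl
    (by simpa [Fin.forall_fin_succ] using ⟨hE, hX.and hA, hX.and (hA.not.and hE.not)⟩)
    (by simpa [Fin.forall_fin_succ] using ⟨⟨b, hxb, hab.1⟩, d, hxd, had, hda⟩)
    (by
      simp only [Fin.forall_fin_succ, Matrix.cons_val_zero, Matrix.cons_val_succ,
        IsEmpty.forall_iff, and_true]
      exact ⟨fun v hv => hv ▸ h.cover x a hxa.1 hx, fun v hv => h.cover x v hv.1.1 hx,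
        fun v hv => h.cover x v hv.1.1 hx⟩)
    (by
      have := G.irrefl (v := a)
      simp [Fin.forall_fin_succ]
      grind)
  have hxp : O.Adj x p := by
    obtain ⟨i, hi⟩ := hcov p rfl
    fin_cases i
    · exact (show p = a from hi) ▸ hxa
    · exact hi.1
    · exact hi.1
  exact hxp.2.2 hp

theorem Stuck.inClique_of_triangle (h : Stuck G χ S T) {x b d : V} (hx : x ∉ S)
    (hxb : (outer G (pinColor G χ T) S).Adj x b) (hxd : (outer G (pinColor G χ T) S).Adj x d)
    (hbd : (outer G (pinColor G χ T) S).Adj b d) :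
    InClique (outer G (pinColor G χ T) S) (pinColor G χ T) x := by
  set O := outer G (pinColor G χ T) S
  have hclique : ∀ y z, O.Adj x y → O.Adj x z → y ≠ z → O.Adj y z := by
    intro y z hxy hxz hyz
    by_cases hyb : y = b
    · exact h.outer_adj_of_common_nbr hx hxy hxd hxz hyz.symm (hyb ▸ hbd)
    · exact h.outer_adj_of_common_nbr hx hxy hxb hxz hyz.symm
        (h.outer_adj_of_common_nbr hx hxb hxd hxy hyb hbd).symm
  intro z hxz
  have hzx : pinColor G χ T z = pinColor G χ T x :=
    (h.pinColor_eq_of_outer_adj hxz hxd).trans (h.pinColor_eq_of_outer_adj hbd hxb.symm)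
  refine ⟨hzx, fun w hwx hwz => ?_⟩
  exact ((equitable_pinColor G χ T).outer S).adj_iff_of_adj_of_imp hzx.symm hxz
    (fun y hyz hxy => hclique z y hxz hxy hyz.symm) hwx hwz

theorem Stuck.inBiclique_or_inClique_of_notMem (h : Stuck G χ S T) {x : V} (hx : x ∉ S) :
    InBiclique (outer G (pinColor G χ T) S) x ∨
      InClique (outer G (pinColor G χ T) S) (pinColor G χ T) x := by
  set O := outer G (pinColor G χ T) S
  by_cases htri : ∃ b d, O.Adj x b ∧ O.Adj x d ∧ O.Adj b d
  · obtain ⟨b, d, hxb, hxd, hbd⟩ := htri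
    exact Or.inr (h.inClique_of_triangle hx hxb hxd hbd)
  · refine Or.inl fun y z hxy hzy w => ?_
    exact h.outer_adj_iff_of_not_adj hx (h.pinColor_eq_of_outer_adj hzy.symm hxy.symm) hxy hzy
      (fun hxz => htri ⟨z, y, hxz, hxy, hzy⟩) w

theorem Stuck.inBiclique_or_inClique (h : Stuck G χ S T) (v : V) :
    InBiclique (outer G (pinColor G χ T) S) v ∨
      InClique (outer G (pinColor G χ T) S) (pinColor G χ T) v := by
  by_cases hv : v ∈ S
  · by_cases hy : ∃ y, (outer G (pinColor G χ T) S).Adj v y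
    · obtain ⟨y, hvy⟩ := hy
      obtain ⟨x, hvx, hx⟩ := h.exists_outer_adj_notMem hv hvy
      exact (h.inBiclique_or_inClique_of_notMem hx).imp (·.of_adj hvx.symm) (·.of_adj hvx.symm)
    · exact Or.inr fun z hvz => absurd ⟨z, hvz⟩ hy
  · exact h.inBiclique_or_inClique_of_notMem hv

end OuterEdges

section Components

variable {V W P Q K : Type*}

theorem card_image_eq_of_card_fiber_eq {s : Finset V} {t : Finset W} {p : V → P} {q : W → Q}
    (hst : #s = #t)
    (h : ∀ v ∈ s, ∀ w ∈ t, #{x ∈ s | p x = p v} = #{y ∈ t | q y = q w}) :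
    #(s.image p) = #(t.image q) := by
  obtain rfl | ⟨v, hv⟩ := s.eq_empty_or_nonempty
  · rw [card_eq_zero.1 hst.symm, image_empty, image_empty, card_empty, card_empty]
  obtain ⟨w, hw⟩ := card_pos.1 (hst ▸ card_pos.2 ⟨v, hv⟩)
  have hs : #s = #(s.image p) * #{y ∈ t | q y = q w} := by
    rw [card_eq_sum_card_image p s]
    exact sum_const_nat (forall_mem_image.2 fun v hv => h v hv w hw)
  have ht : #t = #(t.image q) * #{y ∈ t | q y = q w} := by
    rw [card_eq_sum_card_image q t]
    exact sum_const_nat (forall_mem_image.2 fun y hy => (h v hv y hy).symm.trans (h v hv w hw))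
  exact Nat.eq_of_mul_eq_mul_right (card_pos.2 ⟨w, by simp [hw]⟩) (hs.symm.trans (hst.trans ht))

theorem exists_equiv_of_card_fiber_eq_of_surjective [Fintype V] [Fintype W]
    {p : V → P} {q : W → Q} {s : P → K} {t : Q → K} (hp : p.Surjective) (hq : q.Surjective)
    (e : V ≃ W) (he : ∀ v, t (q (e v)) = s (p v))
    (h : ∀ v w, s (p v) = t (q w) → #{x | p x = p v} = #{y | q y = q w}) :
    ∃ e' : P ≃ Q, ∀ i, t (e' i) = s i := by
  have := Fintype.ofSurjective p hp
  have := Fintype.ofSurjective q hq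
  refine exists_equiv_of_card_fiber_eq fun k => ?_
  rw [← image_univ_of_surjective hp, ← image_univ_of_surjective hq, filter_image, filter_image]
  refine card_image_eq_of_card_fiber_eq (card_equiv e fun x => by simp [he]) fun x hx y hy => ?_
  obtain rfl : s (p x) = k := by simpa using hx
  have hy : t (q y) = s (p x) := by simpa using hy
  rw [filter_filter, filter_filter]
  convert h x y hy.symm using 3 <;> grind

theorem Isomorphic.symm {G : SimpleGraph V} {H : SimpleGraph W} {c : V → K} {d : W → K}
    (h : Isomorphic G c H d) : Isomorphic H d G c :=
  h.elim fun φ hφ => ⟨φ.symm, fun y => by rw [← hφ, φ.apply_symm_apply]⟩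

theorem Isomorphic.trans {U : Type*} {F : SimpleGraph U} {G : SimpleGraph V} {H : SimpleGraph W}
    {b : U → K} {c : V → K} {d : W → K} (h : Isomorphic F b G c) (h' : Isomorphic G c H d) :
    Isomorphic F b H d :=
  h.elim fun φ hφ => h'.elim fun ψ hψ => ⟨φ.trans ψ, fun x => (hψ _).trans (hφ x)⟩

theorem isomorphic_of_forall_component {G : SimpleGraph V} {H : SimpleGraph W} {c : V → K}
    {d : W → K} (e : G.ConnectedComponent ≃ H.ConnectedComponent)
    (h : ∀ i, Isomorphic i.toSimpleGraph (c ∘ Subtype.val) (e i).toSimpleGraph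
      (d ∘ Subtype.val)) : Isomorphic G c H d := by
  choose φ hφ using h
  let F : V ≃ W := (Equiv.sigmaFiberEquiv G.connectedComponentMk).symm.trans
    ((Equiv.sigmaCongr e fun i => (φ i).toEquiv).trans (Equiv.sigmaFiberEquiv _))
  have hF : ∀ i v, ∀ hv : v ∈ i, F v = φ i ⟨v, hv⟩ := by
    rintro _ v rfl
    rfl
  have hcomp : ∀ v, H.connectedComponentMk (F v) = e (G.connectedComponentMk v) :=
    fun v => (φ _ ⟨v, rfl⟩).2
  refine ⟨⟨F, fun {v w} => ?_⟩, fun v => hφ _ ⟨v, rfl⟩⟩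
  by_cases hvw : G.connectedComponentMk v = G.connectedComponentMk w
  · rw [hF _ v rfl, hF _ w hvw.symm]
    exact (φ _).map_adj_iff
  · exact iff_of_false (fun hadj => hvw (e.injective (by
      rw [← hcomp, ← hcomp, SimpleGraph.ConnectedComponent.connectedComponentMk_eq_of_adj hadj])))
      fun hadj => hvw (SimpleGraph.ConnectedComponent.connectedComponentMk_eq_of_adj hadj)

theorem isomorphic_of_equiv_component [Finite V] [Finite W] {G : SimpleGraph V}
    {H : SimpleGraph W} {c : V → K} {d : W → K} (e : V ≃ W)
    (h : ∀ v, Isomorphic (G.connectedComponentMk v).toSimpleGraph (c ∘ Subtype.val)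
      (H.connectedComponentMk (e v)).toSimpleGraph (d ∘ Subtype.val)) : Isomorphic G c H d := by
  have := Fintype.ofFinite V
  have := Fintype.ofFinite W
  let s (i : G.ConnectedComponent) : Set H.ConnectedComponent :=
    {j | Isomorphic i.toSimpleGraph (c ∘ Subtype.val) j.toSimpleGraph (d ∘ Subtype.val)}
  let t (i : H.ConnectedComponent) : Set H.ConnectedComponent :=
    {j | Isomorphic i.toSimpleGraph (d ∘ Subtype.val) j.toSimpleGraph (d ∘ Subtype.val)}
  have hst : ∀ {i j}, s i = t j →
      Isomorphic i.toSimpleGraph (c ∘ Subtype.val) j.toSimpleGraph (d ∘ Subtype.val) :=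
    fun {i j} hij => (Set.ext_iff.1 hij j).2 ⟨.refl, fun _ => rfl⟩
  obtain ⟨e', he'⟩ := exists_equiv_of_card_fiber_eq_of_surjective (s := s) (t := t)
    (p := G.connectedComponentMk) (q := H.connectedComponentMk) (fun i => i.exists_rep)
    (fun j => j.exists_rep) e (fun v => Set.ext fun j => ⟨(h v).trans, (h v).symm.trans⟩)
    fun v w hvw => by
      obtain ⟨φ, -⟩ := hst hvw
      rw [← Fintype.card_subtype, ← Fintype.card_subtype]
      exact Fintype.card_congr φ.toEquiv
  exact isomorphic_of_forall_component e' fun i => hst (he' i).symm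

end Components

section ComponentShapes

variable {V W K : Type*} {O : SimpleGraph V} {O' : SimpleGraph W} {c : V → K} {d : W → K}
  {v y a b : V}

theorem mem_connectedComponentMk_iff {B : V → Prop} (hv : B v)
    (hreach : ∀ a, B a → O.Reachable a v) (hB : ∀ a b, O.Adj a b → B a → B b) :
    a ∈ O.connectedComponentMk v ↔ B a := by
  refine SimpleGraph.ConnectedComponent.eq.trans ⟨fun h => ?_, hreach a⟩
  exact (SimpleGraph.reachable_iff_reflTransGen _ _).1 h.symm |>.rec hv
    fun _ hab ha => hB _ _ hab ha

theorem InClique.mem_connectedComponentMk (h : InClique O c v) :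
    a ∈ O.connectedComponentMk v ↔ a = v ∨ O.Adj v a := by
  refine mem_connectedComponentMk_iff (B := fun a => a = v ∨ O.Adj v a) (Or.inl rfl) ?_ ?_
  · rintro a (rfl | hva)
    · rfl
    · exact hva.symm.reachable
  · rintro a b hab (rfl | hva)
    · exact Or.inr hab
    · exact or_iff_not_imp_left.2 fun hbv => ((h a hva).2 b hbv hab.ne').2 hab

theorem InClique.adj_iff_ne (h : InClique O c v) (ha : a ∈ O.connectedComponentMk v)
    (hb : b ∈ O.connectedComponentMk v) : O.Adj a b ↔ a ≠ b := by
  refine ⟨fun hab => hab.ne, fun hab => ?_⟩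
  rcases h.mem_connectedComponentMk.1 ha with rfl | hva
  · exact (h.mem_connectedComponentMk.1 hb).resolve_left hab.symm
  · rcases h.mem_connectedComponentMk.1 hb with rfl | hvb
    · exact hva.symm
    · exact ((h a hva).2 b hvb.ne' hab.symm).1 hvb

theorem InBiclique.mem_connectedComponentMk (h : InBiclique O v) (hvy : O.Adj v y) :
    a ∈ O.connectedComponentMk v ↔ O.Adj v a ∨ O.Adj y a := by
  refine mem_connectedComponentMk_iff (B := fun a => O.Adj v a ∨ O.Adj y a)
    (Or.inr hvy.symm) ?_ ?_
  · rintro a (hva | hya)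
    · exact hva.symm.reachable
    · exact hya.symm.reachable.trans hvy.symm.reachable
  · rintro a b hab (hva | hya)
    · exact Or.inr ((h.of_adj hvy v a hvy.symm hva.symm b).2 hab)
    · exact Or.inl ((h y a hvy hya.symm b).2 hab)

theorem InBiclique.adj_iff (h : InBiclique O v) (hvy : O.Adj v y)
    (ha : a ∈ O.connectedComponentMk v) (hb : b ∈ O.connectedComponentMk v) :
    O.Adj a b ↔ ¬ (O.Adj v a ↔ O.Adj v b) := by
  have adj_y_iff : ∀ {x}, x ∈ O.connectedComponentMk v → (O.Adj y x ↔ ¬ O.Adj v x) :=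
    fun hx => ⟨fun hyx hvx => O.irrefl ((h y _ hvy hyx.symm _).1 hvx),
      ((h.mem_connectedComponentMk hvy).1 hx).resolve_left⟩
  by_cases hva : O.Adj v a
  · rw [← h.of_adj hvy v a hvy.symm hva.symm b, adj_y_iff hb, iff_true_left hva]
  · rw [← h y a hvy ((adj_y_iff ha).2 hva).symm b, iff_false_left hva, not_not]

theorem isomorphic_component_of_equiv {w : W} (h : V ≃ W) (hc : ∀ a, d (h a) = c a)
    (hmem : ∀ a, a ∈ O.connectedComponentMk v ↔ h a ∈ O'.connectedComponentMk w)
    (hadj : ∀ a ∈ O.connectedComponentMk v, ∀ b ∈ O.connectedComponentMk v,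
      (O.Adj a b ↔ O'.Adj (h a) (h b))) :
    Isomorphic (O.connectedComponentMk v).toSimpleGraph (c ∘ Subtype.val)
      (O'.connectedComponentMk w).toSimpleGraph (d ∘ Subtype.val) :=
  ⟨⟨h.subtypeEquiv hmem, fun {a b} => (hadj a a.2 b b.2).symm⟩, fun a => hc a⟩

end ComponentShapes

section PairTransfer

variable {V : Type u} {K : Type v} {G H : SimpleGraph V} {c : V → K}

/-- `G` and `H` agree, up to the colors `c`, in the bijective game with three pebbles that starts
with a pebble on the same vertex of both graphs: `g` answers the placement of the second pebble,
and `h` that of the third. -/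
def PairTransfer (c : V → K) (G H : SimpleGraph V) : Prop :=
  ∀ v, ∃ g : V ≃ V, ∀ z, ∃ h : V ≃ V, h v = v ∧ h z = g z ∧
    ∀ y, c (h y) = c y ∧ (G.Adj v y ↔ H.Adj v (h y)) ∧ (G.Adj z y ↔ H.Adj (g z) (h y))

theorem PairTransfer.symm (ht : PairTransfer c G H) : PairTransfer c H G := by
  intro v
  obtain ⟨g, hg⟩ := ht v
  refine ⟨g.symm, fun z => ?_⟩
  obtain ⟨h, hv, hz, hh⟩ := hg (g.symm z)
  rw [g.apply_symm_apply] at hz hh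
  refine ⟨h.symm, h.symm_apply_eq.2 hv.symm, h.symm_apply_eq.2 hz.symm, fun y => ?_⟩
  obtain ⟨hc, hvy, hzy⟩ := hh (h.symm y)
  rw [h.apply_symm_apply] at hc hvy hzy
  exact ⟨hc.symm, hvy.symm, hzy.symm⟩

theorem PairTransfer.exists_equiv (ht : PairTransfer c G H) (v : V) :
    ∃ h : V ≃ V, ∀ y, c (h y) = c y ∧ (G.Adj v y ↔ H.Adj v (h y)) := by
  obtain ⟨g, hg⟩ := ht v
  obtain ⟨h, -, -, hh⟩ := hg v
  exact ⟨h, fun y => ⟨(hh y).1, (hh y).2.1⟩⟩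

theorem PairTransfer.exists_adj (ht : PairTransfer c G H) (hc : Equitable G c) {v w x : V}
    (hvw : c v = c w) (hvx : H.Adj v x) : ∃ y, G.Adj w y := by
  obtain ⟨h, hh⟩ := ht.symm.exists_equiv v
  obtain ⟨y, -, hwy⟩ := hc.exists_adj hvw ((hh x).2.1 hvx)
  exact ⟨y, hwy⟩

theorem PairTransfer.card_nbrs_eq [Fintype V] (ht : PairTransfer c G H) (v : V) {B : V → Prop}
    (hB : Saturated c B) : #(nbrs G v B) = #(nbrs H v B) := by
  obtain ⟨h, hh⟩ := ht.exists_equiv v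
  refine card_bijective h h.bijective fun z => ?_
  rw [mem_nbrs, mem_nbrs, (hh z).2, hB _ _ (hh z).1]

theorem PairTransfer.card_nbrs_eq_of_color_eq [Fintype V] (ht : PairTransfer c G H)
    (hc : Equitable G c) {x y : V} (hxy : c x = c y) {B : V → Prop} (hB : Saturated c B) :
    #(nbrs G x B) = #(nbrs H y B) :=
  (hc.card_nbrs_eq hB hxy).trans (ht.card_nbrs_eq y hB)

theorem PairTransfer.adj_iff_of_forall_color_eq [Finite V] (ht : PairTransfer c G H)
    (hc : Equitable G c) {x y p : V} (hxy : c x = c y)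
    (h : ∀ a b, c a = c p → c b = c p → G.Adj x a → G.Adj x b) : G.Adj x p ↔ H.Adj y p :=
  have := Fintype.ofFinite V
  adj_iff_of_card_nbrs_eq_of_forall
    (ht.card_nbrs_eq_of_color_eq hc hxy (saturated_color_eq c (c p))) h rfl

theorem PairTransfer.outer (ht : PairTransfer c G H) (S : Finset V) :
    PairTransfer c (outer G c S) (outer H c S) := by
  intro v
  obtain ⟨g, hg⟩ := ht v
  refine ⟨g, fun z => ?_⟩
  obtain ⟨h, hv, hz, hh⟩ := hg z
  have hin : ∀ y, Inside c S y ↔ Inside c S (h y) := fun y =>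
    saturated_inside c S _ _ (hh y).1.symm
  exact ⟨h, hv, hz, fun y => ⟨(hh y).1, and_congr (hh y).2.1 (and_congr_right' (hin y).not),
    and_congr (hh y).2.2 (and_congr (hz ▸ (hin z).not) (hin y).not)⟩⟩

theorem PairTransfer.inBiclique (ht : PairTransfer c G H) {v : V} (hv : InBiclique G v) :
    InBiclique H v := by
  intro y z hvy hzy w
  obtain ⟨g, hg⟩ := ht.symm v
  obtain ⟨h, -, -, hh⟩ := hg z
  rw [(hh w).2.1, (hh w).2.2]
  exact hv (h y) (g z) ((hh y).2.1.1 hvy) ((hh y).2.2.1 hzy) (h w)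

theorem PairTransfer.inClique (ht : PairTransfer c G H) {v : V} (hv : InClique G c v) :
    InClique H c v := by
  intro z hvz
  obtain ⟨g, hg⟩ := ht.symm v
  obtain ⟨h, hhv, hhz, hh⟩ := hg z
  obtain ⟨hc, hw⟩ := hv (h z) ((hh z).2.1.1 hvz)
  refine ⟨(hh z).1.symm.trans hc, fun w hwv hwz => ?_⟩
  rw [(hh w).2.1, (hh w).2.2, ← hhz]
  exact hw (h w) (fun hw => hwv (h.injective (hw.trans hhv.symm))) (h.injective.ne hwz)

theorem PairTransfer.isomorphic_component (ht : PairTransfer c G H) {v : V}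
    (hv : InBiclique G v ∨ InClique G c v) :
    Isomorphic (G.connectedComponentMk v).toSimpleGraph (c ∘ Subtype.val)
      (H.connectedComponentMk v).toSimpleGraph (c ∘ Subtype.val) := by
  by_cases hclique : InClique G c v
  · obtain ⟨g, hg⟩ := ht v
    obtain ⟨h, hhv, -, hh⟩ := hg v
    have hmem : ∀ a, a ∈ G.connectedComponentMk v ↔ h a ∈ H.connectedComponentMk v := fun a => by
      rw [hclique.mem_connectedComponentMk, (ht.inClique hclique).mem_connectedComponentMk,
        ← (hh a).2.1, ← h.injective.eq_iff, hhv]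
    refine isomorphic_component_of_equiv h (fun a => (hh a).1) hmem fun a ha b hb => ?_
    rw [hclique.adj_iff_ne ha hb, (ht.inClique hclique).adj_iff_ne ((hmem a).1 ha) ((hmem b).1 hb),
      h.injective.ne_iff]
  · obtain ⟨y, hvy⟩ : ∃ y, G.Adj v y := by
      by_contra! hv
      exact hclique fun z hvz => absurd hvz (hv z)
    have hbi := hv.resolve_right hclique
    obtain ⟨g, hg⟩ := ht v
    obtain ⟨h, -, hhy, hh⟩ := hg y
    have hvy' : H.Adj v (g y) := hhy ▸ (hh y).2.1.1 hvy
    have hmem : ∀ a, a ∈ G.connectedComponentMk v ↔ h a ∈ H.connectedComponentMk v := fun a => by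
      rw [hbi.mem_connectedComponentMk hvy, (ht.inBiclique hbi).mem_connectedComponentMk hvy',
        (hh a).2.1, (hh a).2.2]
    refine isomorphic_component_of_equiv h (fun a => (hh a).1) hmem fun a ha b hb => ?_
    rw [hbi.adj_iff hvy ha hb,
      (ht.inBiclique hbi).adj_iff hvy' ((hmem a).1 ha) ((hmem b).1 hb), (hh a).2.1, (hh b).2.1]

theorem PairTransfer.isomorphic [Finite V] (ht : PairTransfer c G H)
    (h : ∀ v, InBiclique G v ∨ InClique G c v) : Isomorphic G c H c :=
  isomorphic_of_equiv_component (Equiv.refl V) fun v => ht.isomorphic_component (h v)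

end PairTransfer

section Isomorphism

variable {V : Type u} [Fintype V] {C : Type v} {G H : SimpleGraph V} {χ : V → C}
  {S T : Finset V}

theorem Stuck.exists_perm_adj_iff_of_color_eq (h : Stuck G χ S T)
    (ht : PairTransfer (pinColor G χ T) G H) {p : V} (hp : Inside (pinColor G χ T) S p) (v : V) :
    ∃ e : Equiv.Perm {x // pinColor G χ T x = pinColor G χ T v},
      ∀ (x : {x // pinColor G χ T x = pinColor G χ T v}) (a : V),
        pinColor G χ T a = pinColor G χ T p → (G.Adj x a ↔ H.Adj (e x) a) := by
  have hc := equitable_pinColor G χ T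
  have hp' := saturated_color_eq (pinColor G χ T) (pinColor G χ T p)
  have filter_adj : ∀ (F : SimpleGraph V) x,
      (univ.filter fun z => pinColor G χ T z = pinColor G χ T p).filter (F.Adj x) =
        nbrs F x fun z => pinColor G χ T z = pinColor G χ T p := fun F x => by
    simp only [nbrs, filter_filter, and_comm]
  obtain ⟨e, he⟩ := exists_perm_of_card_block
    (P := univ.filter fun z => pinColor G χ T z = pinColor G χ T p)
    (W := {x // pinColor G χ T x = pinColor G χ T v}) (B := fun x => G.Adj x)
    (B' := fun x => H.Adj x) (k := #(nbrs G v fun z => pinColor G χ T z = pinColor G χ T p))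
    (fun x => by rw [filter_adj, hc.card_nbrs_eq hp' x.2])
    (fun x => by rw [filter_adj, ht.card_nbrs_eq_of_color_eq hc x.2.symm hp'])
    (h.card_block hp v) fun a _ => by
      obtain ⟨f, hf⟩ := ht.exists_equiv a
      refine card_equiv (f.subtypeEquiv fun x => by rw [(hf x).1]) fun x => ?_
      simpa [G.adj_comm _ a, H.adj_comm _ a] using (hf x).2
  exact ⟨e, fun x a ha => he x a (mem_filter.2 ⟨mem_univ a, ha⟩)⟩

theorem Stuck.exists_perm_adj_iff_of_inside (h : Stuck G χ S T)
    (ht : PairTransfer (pinColor G χ T) G H) (v : V) :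
    ∃ e : Equiv.Perm {x // pinColor G χ T x = pinColor G χ T v},
      ∀ (x : {x // pinColor G χ T x = pinColor G χ T v}) (p : V),
        Inside (pinColor G χ T) S p → (G.Adj x p ↔ H.Adj (e x) p) := by
  have hc := equitable_pinColor G χ T
  by_cases hsplit : ∃ p a b, Inside (pinColor G χ T) S p ∧ pinColor G χ T a = pinColor G χ T p ∧
      pinColor G χ T b = pinColor G χ T p ∧ G.Adj v a ∧ ¬ G.Adj v b
  · obtain ⟨p, a, b, hp, ha, hb, hva, hvb⟩ := hsplit
    obtain ⟨e, he⟩ := h.exists_perm_adj_iff_of_color_eq ht hp v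
    refine ⟨e, fun x q hq => ?_⟩
    by_cases hqp : pinColor G χ T q = pinColor G χ T p
    · exact he x q hqp
    · obtain ⟨f, hf⟩ := hc v x x.2.symm
      exact ht.adj_iff_of_forall_color_eq hc (x.2.trans (e x).2.symm) fun y z hy hz hxy =>
        h.adj_of_split hp hq (Ne.symm hqp) ((hf a).1.trans ha) ((hf b).1.trans hb) hy hz
          ((hf a).2.1 hva) (fun hxb => hvb ((hf b).2.2 hxb)) hxy
  · push Not at hsplit
    refine ⟨Equiv.refl _, fun x p hp => ht.adj_iff_of_forall_color_eq hc rfl ?_⟩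
    intro a b ha hb hxa
    obtain ⟨f, hf⟩ := hc x v x.2
    exact (hf b).2.2 (hsplit p (f a) (f b) hp ((hf a).1.trans ha) ((hf b).1.trans hb)
      ((hf a).2.1 hxa))

theorem Stuck.adj_iff_of_inside (h : Stuck G χ S T) (ht : PairTransfer (pinColor G χ T) G H)
    {u v : V} (hu : Inside (pinColor G χ T) S u) (hv : Inside (pinColor G χ T) S v) :
    G.Adj u v ↔ H.Adj u v := by
  by_cases huv : pinColor G χ T u = pinColor G χ T v
  · obtain rfl | hne := eq_or_ne v u
    · exact iff_of_false G.irrefl H.irrefl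
    have nbrs_eq : ∀ F : SimpleGraph V, nbrs F u (fun z => pinColor G χ T z = pinColor G χ T u) =
        nbrs F u fun z => pinColor G χ T z = pinColor G χ T u ∧ z ≠ u := by
      intro F
      ext z
      rw [mem_nbrs, mem_nbrs]
      exact and_congr_right fun hz => (and_iff_left hz.ne').symm
    have hcard := ht.card_nbrs_eq u (saturated_color_eq _ (pinColor G χ T u))
    rw [nbrs_eq, nbrs_eq] at hcard
    exact adj_iff_of_card_nbrs_eq_of_forall hcard
      (fun a b ha hb => (h.adj_iff_of_pinColor_eq hu ha.1 hb.1 ha.2 hb.2).1) ⟨huv.symm, hne⟩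
  · exact ht.adj_iff_of_forall_color_eq (equitable_pinColor G χ T) rfl
      fun a b ha hb => h.adj_of_inside hu hv huv ha hb

theorem Stuck.exists_perm_fiber (h : Stuck G χ S T) (ht : PairTransfer (pinColor G χ T) G H)
    {μ : Equiv.Perm V} (hμ : ∀ v, pinColor G χ T (μ v) = pinColor G χ T v) (v : V) :
    ∃ e : Equiv.Perm {x // pinColor G χ T x = pinColor G χ T v},
      ∀ x : {x // pinColor G χ T x = pinColor G χ T v},
      (Inside (pinColor G χ T) S x → (e x : V) = x) ∧
      (∀ y, (outer G (pinColor G χ T) S).Adj x y → (e x : V) = μ x) ∧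
      (¬ Inside (pinColor G χ T) S x →
        ∀ p, Inside (pinColor G χ T) S p → (G.Adj x p ↔ H.Adj (e x) p)) := by
  have hc := equitable_pinColor G χ T
  have hS : ∀ x : {x // pinColor G χ T x = pinColor G χ T v},
      Inside (pinColor G χ T) S x ↔ Inside (pinColor G χ T) S v := fun x =>
    saturated_inside _ S _ _ x.2
  by_cases hv : Inside (pinColor G χ T) S v
  · exact ⟨Equiv.refl _, fun x => ⟨fun _ => rfl, fun y hxy => absurd ((hS x).2 hv) hxy.2.1,
      fun hx => absurd ((hS x).2 hv) hx⟩⟩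
  by_cases hiso : ∃ y, (outer G (pinColor G χ T) S).Adj v y
  · obtain ⟨y, hvy⟩ := hiso
    refine ⟨μ.subtypeEquiv fun x => by rw [hμ], fun x => ⟨fun hx => absurd ((hS x).1 hx) hv,
      fun _ _ => rfl, fun _ p hp => ht.adj_iff_of_forall_color_eq hc (hμ x).symm ?_⟩⟩
    obtain ⟨z, -, hxz⟩ := (hc.outer S).exists_adj x.2.symm hvy
    exact fun a b ha hb => h.adj_of_outer_adj hxz hp ha hb
  · obtain ⟨e, he⟩ := h.exists_perm_adj_iff_of_inside ht v
    refine ⟨e, fun x => ⟨fun hx => absurd ((hS x).1 hx) hv, fun y hxy => ?_, fun _ => he x⟩⟩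
    obtain ⟨z, -, hvz⟩ := (hc.outer S).exists_adj x.2 hxy
    exact absurd ⟨z, hvz⟩ hiso

theorem Stuck.exists_perm (h : Stuck G χ S T) (ht : PairTransfer (pinColor G χ T) G H)
    {μ : Equiv.Perm V} (hμ : ∀ v, pinColor G χ T (μ v) = pinColor G χ T v) :
    ∃ f : Equiv.Perm V, ∀ x, pinColor G χ T (f x) = pinColor G χ T x ∧
      (Inside (pinColor G χ T) S x → f x = x) ∧
      (∀ y, (outer G (pinColor G χ T) S).Adj x y → f x = μ x) ∧
      (¬ Inside (pinColor G χ T) S x →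
        ∀ p, Inside (pinColor G χ T) S p → (G.Adj x p ↔ H.Adj (f x) p)) := by
  refine exists_perm_of_forall_fiber (Q := fun x y => (Inside (pinColor G χ T) S x → y = x) ∧
    (∀ z, (outer G (pinColor G χ T) S).Adj x z → y = μ x) ∧
    (¬ Inside (pinColor G χ T) S x →
      ∀ p, Inside (pinColor G χ T) S p → (G.Adj x p ↔ H.Adj y p))) fun k => ?_
  by_cases hk : ∃ v, pinColor G χ T v = k
  · obtain ⟨v, rfl⟩ := hk
    exact h.exists_perm_fiber ht hμ v
  · exact ⟨Equiv.refl _, fun x => absurd ⟨x.1, x.2⟩ hk⟩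

theorem Stuck.isomorphic_of_pairTransfer (h : Stuck G χ S T)
    (ht : PairTransfer (pinColor G χ T) G H) :
    Isomorphic G (pinColor G χ T) H (pinColor G χ T) := by
  obtain ⟨μ, hμ⟩ := (ht.outer S).isomorphic h.inBiclique_or_inClique
  obtain ⟨f, hf⟩ := h.exists_perm ht (μ := μ.toEquiv) hμ
  have inside_iff : ∀ x, Inside (pinColor G χ T) S (f x) ↔ Inside (pinColor G χ T) S x :=
    fun x => saturated_inside _ S _ _ (hf x).1
  have outer_adj_iff : ∀ x y, (outer H (pinColor G χ T) S).Adj (f x) (f y) ↔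
      (outer G (pinColor G χ T) S).Adj x y := by
    have hO := (equitable_pinColor G χ T).outer S
    have map_adj : ∀ {x y x' y'}, (outer G (pinColor G χ T) S).Adj x x' →
        (outer G (pinColor G χ T) S).Adj y y' → ((outer H (pinColor G χ T) S).Adj (f x) (f y) ↔
          (outer G (pinColor G χ T) S).Adj x y) := fun {x y _ _} hx hy => by
      rw [(hf x).2.2.1 _ hx, (hf y).2.2.1 _ hy]
      exact μ.map_adj_iff
    refine fun x y => ⟨fun hxy => ?_, fun hxy => (map_adj hxy hxy.symm).2 hxy⟩
    obtain ⟨x', hx⟩ := (ht.outer S).exists_adj hO (hf x).1 hxy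
    obtain ⟨y', hy⟩ := (ht.outer S).exists_adj hO (hf y).1 hxy.symm
    exact (map_adj hx hy).1 hxy
  refine ⟨⟨f, fun {x y} => ?_⟩, fun x => (hf x).1⟩
  by_cases hx : Inside (pinColor G χ T) S x <;> by_cases hy : Inside (pinColor G χ T) S y
  · rw [(hf x).2.1 hx, (hf y).2.1 hy, h.adj_iff_of_inside ht hx hy]
  · rw [(hf x).2.1 hx, G.adj_comm, H.adj_comm, (hf y).2.2.2 hy x hx]
  · rw [(hf y).2.1 hy, (hf x).2.2.2 hx y hy]
  · simpa only [outer, inside_iff, hx, hy, not_false_eq_true, and_true] using outer_adj_iff x y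

end Isomorphism

section TupleBisimulation

variable {V : Type u} {W : Type v} {C : Type w} {ι : Type*} [DecidableEq ι]
  {G : SimpleGraph V} {χ : V → C} {H : SimpleGraph W} {ψ : W → C}

/-- An invariant of the bijective game on tuples: to a bijection `f` chosen by Duplicator, Spoiler
answers by replacing any entry `i` of the two tuples by a vertex and its image. -/
def IsTupleBisimulation (G : SimpleGraph V) (χ : V → C) (H : SimpleGraph W) (ψ : W → C)
    (E : (ι → V) → (ι → W) → Prop) : Prop :=
  ∀ x y, E x y → (∀ i, χ (x i) = ψ (y i)) ∧
    (∀ i j, (x i = x j ↔ y i = y j) ∧ (G.Adj (x i) (x j) ↔ H.Adj (y i) (y j))) ∧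
    ∃ f : V ≃ W, ∀ i z, E (Function.update x i z) (Function.update y i (f z))

variable {E : (ι → V) → (ι → W) → Prop}

theorem IsTupleBisimulation.exists_equiv (hE : IsTupleBisimulation G χ H ψ E) {x : ι → V}
    {y : ι → W} (hxy : E x y) :
    ∃ f : V ≃ W, ∀ i z, E (Function.update x i z) (Function.update y i (f z)) ∧
      ∀ j, j ≠ i → (x j = z ↔ y j = f z) ∧ (G.Adj (x j) z ↔ H.Adj (y j) (f z)) := by
  obtain ⟨-, -, f, hf⟩ := hE x y hxy
  refine ⟨f, fun i z => ⟨hf i z, fun j hj => ?_⟩⟩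
  simpa only [Function.update_self, Function.update_of_ne hj] using (hE _ _ (hf i z)).2.1 j i

theorem IsTupleBisimulation.stableColor_eq [Nontrivial ι] (hE : IsTupleBisimulation G χ H ψ E)
    {x x' : ι → V} {y y' : ι → W} (hxy : E x y) (hxy' : E x' y') {i i' : ι}
    (h : y i = y' i') : stableColor G χ (x i) = stableColor G χ (x' i') := by
  rw [stableColor_eq_iff]
  refine ⟨fun v v' => ∃ x y x' y' i i', E x y ∧ E x' y' ∧ x i = v ∧ x' i' = v' ∧ y i = y' i',
    ?_, x, y, x', y', i, i', hxy, hxy', rfl, rfl, h⟩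
  rintro _ _ ⟨x, y, x', y', i, i', hxy, hxy', rfl, rfl, h⟩
  refine ⟨((hE x y hxy).1 i).trans (((hE x' y' hxy').1 i').trans (h ▸ rfl)).symm, ?_⟩
  obtain ⟨f, hf⟩ := hE.exists_equiv hxy
  obtain ⟨f', hf'⟩ := hE.exists_equiv hxy'
  obtain ⟨j, hj⟩ := exists_ne i
  obtain ⟨j', hj'⟩ := exists_ne i'
  refine ⟨f.trans f'.symm, fun z => ?_⟩
  have hz := hf j z
  have hz' := hf' j' (f'.symm (f z))
  refine ⟨⟨_, _, _, _, j, j', hz.1, hz'.1, by simp, by simp, by simp⟩, (hz.2 i hj.symm).2.trans ?_⟩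
  rw [h, Equiv.trans_apply, (hz'.2 i' hj'.symm).2, f'.apply_symm_apply]

theorem IsTupleBisimulation.exists_pairTransfer {E : (Fin 3 → V) → (Fin 3 → W) → Prop}
    (hE : IsTupleBisimulation G χ H ψ E) {x : Fin 3 → V} {y : Fin 3 → W} (hxy : E x y) :
    ∃ f : V ≃ W, (∀ v, ψ (f v) = χ v) ∧ PairTransfer (stableColor G χ) G (H.comap f) := by
  obtain ⟨f, hf⟩ := hE.exists_equiv hxy
  have color_eq : ∀ {x' : Fin 3 → V} {y' : Fin 3 → W}, E x' y' → ∀ i,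
      stableColor G χ (f.symm (y' i)) = stableColor G χ (x' i) := fun hxy' i => by
    simpa using hE.stableColor_eq (hf 0 _).1 hxy' (i := 0) (i' := i) (by simp)
  refine ⟨f, fun v => by simpa using ((hE _ _ (hf 0 v).1).1 0).symm, fun v => ?_⟩
  obtain ⟨g, hg⟩ := hE.exists_equiv (hf 0 v).1
  refine ⟨g.trans f.symm, fun z => ?_⟩
  obtain ⟨h, hh⟩ := hE.exists_equiv (hg 1 z).1
  have h₀ := fun a => (hh 2 a).2 0 (by decide)
  have h₁ := fun a => (hh 2 a).2 1 (by decide)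
  simp only [Function.update_self, ne_eq, zero_ne_one, not_false_eq_true,
    Function.update_of_ne] at h₀ h₁
  refine ⟨h.trans f.symm, ?_, ?_, fun a => ⟨?_, ?_, ?_⟩⟩
  · simpa [f.symm_apply_eq] using ((h₀ v).1.1 rfl).symm
  · simpa using ((h₁ z).1.1 rfl).symm
  · simpa using color_eq (hh 2 a).1 2
  · simpa using (h₀ a).2
  · simpa using (h₁ a).2

theorem IsTupleBisimulation.comp {κ : Type*} [DecidableEq κ]
    (hE : IsTupleBisimulation G χ H ψ E) (a : κ ↪ ι) :
    IsTupleBisimulation G χ H ψ fun x y => ∃ X Y, E X Y ∧ X ∘ a = x ∧ Y ∘ a = y := by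
  rintro _ _ ⟨X, Y, hXY, rfl, rfl⟩
  obtain ⟨hχ, hpair, f, hf⟩ := hE X Y hXY
  exact ⟨fun i => hχ (a i), fun i j => hpair (a i) (a j), f, fun i z => ⟨_, _, hf (a i) z,
    Function.update_comp_eq_of_injective _ a.injective _ _,
    Function.update_comp_eq_of_injective _ a.injective _ _⟩⟩

theorem IsTupleBisimulation.individualize {T : Finset V} {E : (T ⊕ ι → V) → (T ⊕ ι → W) → Prop}
    (hE : IsTupleBisimulation G χ H ψ E) (t : T → W) :
    IsTupleBisimulation G (individualize χ T) H
      (fun w => (ψ w, T.filter fun v => ∃ hv : v ∈ T, t ⟨v, hv⟩ = w))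
      fun x y => E (Sum.elim Subtype.val x) (Sum.elim t y) := by
  intro x y hxy
  obtain ⟨hχ, hpair, f, hf⟩ := hE _ _ hxy
  refine ⟨fun i => Prod.ext (hχ (.inr i)) ?_, fun i j => hpair (.inr i) (.inr j), f, fun i z => ?_⟩
  · ext v
    simp only [WeisfeilerLeman.individualize, mem_inter, mem_singleton, mem_filter]
    exact and_congr_right fun hv =>
      (hpair (.inl ⟨v, hv⟩) (.inr i)).1.trans
        (exists_prop_of_true (q := fun hv => t ⟨v, hv⟩ = y i) hv).symm
  · simpa only [Sum.update_elim_inr] using hf (.inr i) z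

theorem IsTupleBisimulation.exists_individualize [Nonempty V] {k n : ℕ}
    {E : (Fin k → V) → (Fin k → W) → Prop} (hE : IsTupleBisimulation G χ H ψ E)
    (hne : ∀ x, ∃ y, E x y) {T : Finset V} (hT : #T + n ≤ k) :
    ∃ (ψ' : W → C × Finset V) (E' : (Fin n → V) → (Fin n → W) → Prop),
      IsTupleBisimulation G (WeisfeilerLeman.individualize χ T) H ψ' E' ∧
        (∀ w, (ψ' w).1 = ψ w) ∧ ∃ x y, E' x y := by
  obtain ⟨a⟩ : Nonempty (T ⊕ Fin n ↪ Fin k) :=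
    Function.Embedding.nonempty_of_card_le (by simpa using hT)
  have v : V := Classical.ofNonempty
  obtain ⟨y, hxy⟩ := hne (Function.extend a (Sum.elim Subtype.val fun _ => v) fun _ => v)
  exact ⟨_, _, (hE.comp a).individualize (y ∘ a ∘ Sum.inl), fun w => rfl, fun _ => v,
    y ∘ a ∘ Sum.inr, _, y, hxy, Function.extend_comp a.injective _ _,
    (Sum.elim_comp_inl_inr (y ∘ a)).symm⟩

end TupleBisimulation

section WeisfeilerLemanBisimulation

variable {V : Type u} {W : Type v} {C : Type w} [Fintype V] [Fintype W] {k i : ℕ}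
  {G : SimpleGraph V} {χ : V → C} {H : SimpleGraph W} {ψ : W → C} {x : Fin k → V} {y : Fin k → W}

theorem atomicType_eq_of_wlRound_eq (h : wlRound k G χ i x = wlRound k H ψ i y) :
    atomicType G χ x = atomicType H ψ y := by
  induction i with
  | zero => exact h
  | succ i ih => exact ih (congrArg Prod.fst h)

theorem exists_equiv_of_wlRound_succ_eq (hk : k ≠ 1)
    (h : wlRound k G χ (i + 1) x = wlRound k H ψ (i + 1) y) :
    ∃ f : V ≃ W, ∀ j z, wlRound k G χ i (Function.update x j z) =
      wlRound k H ψ i (Function.update y j (f z)) := by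
  have hmap := congrArg Prod.snd h
  simp only [wlRound, hk, false_imp_iff, filter_true] at hmap
  obtain ⟨f, hf⟩ := exists_equiv_of_map_eq hmap
  exact ⟨f, fun j z => (congrFun (hf z) j).symm⟩

theorem isTupleBisimulation_wlRound (hk : k ≠ 1) (hi : i ∈ stableRounds k G χ)
    (h : ∀ y, ∃ x, wlRound k G χ (i + 1) x = wlRound k H ψ (i + 1) y) :
    IsTupleBisimulation G χ H ψ fun x y => wlRound k G χ i x = wlRound k H ψ i y := by
  intro x y hxy
  have hatom := atomicType_eq_of_wlRound_eq hxy
  refine ⟨fun a => congrFun (congrArg AtomicType.color hatom) a, fun a b =>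
    ⟨iff_of_eq (congrFun (congrFun (congrArg AtomicType.eq hatom) a) b),
      iff_of_eq (congrFun (congrFun (congrArg AtomicType.adj hatom) a) b)⟩, ?_⟩
  obtain ⟨x', hx'⟩ := h y
  exact exists_equiv_of_wlRound_succ_eq hk
    ((hi.1 _ _ (hxy.trans (congrArg Prod.fst hx').symm)).trans hx')

theorem exists_isTupleBisimulation [Nonempty V] (hk : k ≠ 1) (h : ¬ Distinguishes k G χ H ψ) :
    ∃ E : (Fin k → V) → (Fin k → W) → Prop,
      IsTupleBisimulation G χ H ψ E ∧ ∀ x, ∃ y, E x y := by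
  rw [Distinguishes, not_not] at h
  obtain ⟨e, he⟩ := exists_equiv_of_map_eq h
  obtain ⟨x₀⟩ : Nonempty (Fin k → V) := inferInstance
  have hround : stableRound k H ψ = stableRound k G χ :=
    Nat.succ.inj (congrArg Sigma.fst (he x₀))
  have hwl : ∀ x, wlRound k G χ (stableRound k G χ + 1) x =
      wlRound k H ψ (stableRound k G χ + 1) (e x) := fun x => by
    have hx := he x
    rw [wl, wl, hround] at hx
    exact (eq_of_heq (Sigma.mk.inj hx).2).symm
  exact ⟨_, isTupleBisimulation_wlRound hk (Nat.sInf_mem (stableRounds_nonempty k G χ))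
    fun y => ⟨e.symm y, (hwl _).trans (by rw [e.apply_symm_apply]; rfl)⟩,
    fun x => ⟨e x, congrArg Prod.fst (hwl x)⟩⟩

end WeisfeilerLemanBisimulation

section Identification

variable {V : Type u} [Fintype V] {C : Type v} {G : SimpleGraph V} {χ : V → C} {S T : Finset V}

theorem Stuck.identifies [Nonempty V] (h : Stuck G χ S T) {k : ℕ} (hk : #T + 3 ≤ k) :
    Identifies k G χ := by
  intro W _ _ H ψ hiso
  by_contra hd
  obtain ⟨E, hE, hne⟩ := exists_isTupleBisimulation (by omega) hd
  obtain ⟨ψ', E', hE', hψ, x, y, hxy⟩ := hE.exists_individualize hne hk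
  obtain ⟨f, hf, ht⟩ := hE'.exists_pairTransfer hxy
  obtain ⟨φ, hφ⟩ := h.isomorphic_of_pairTransfer ht
  refine hiso ⟨φ.trans (SimpleGraph.Iso.comap f H), fun x => ?_⟩
  calc ψ (f (φ x)) = (individualize χ T (φ x)).1 := by rw [← hf, hψ]
    _ = χ x := (individualize_eq_iff.1 (refines_stableColor G _ _ _ (hφ x))).1

theorem exists_stuck (G : SimpleGraph V) (χ : V → C)
    (hS : ∀ u v, G.Adj u v → u ∉ S → v ∈ S) : ∃ T, Stuck G χ S T ∧ 3 * #T ≤ 2 * #S := by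
  obtain ⟨T, hT, hmax⟩ := exists_max_image
    (univ.filter fun T : Finset V => 3 * #T ≤ 2 * #(insideColors (pinColor G χ T) S))
    (fun T => #(insideColors (pinColor G χ T) S)) ⟨∅, by simp⟩
  simp only [mem_filter, mem_univ, true_and] at hT hmax
  refine ⟨T, ⟨hS, fun T' _ hT' => ?_⟩,
    hT.trans (Nat.mul_le_mul_left 2 (card_insideColors_le _ S))⟩
  by_contra! hgain
  have hle := hmax T' (by omega)
  have := card_le_card ‹T ⊆ T'›
  omega

theorem identifies_of_isVertexCover [Nonempty V] (G : SimpleGraph V) (χ : V → C)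
    (hS : G.IsVertexCover S) : Identifies (2 * #S / 3 + 3) G χ := by
  obtain ⟨T, hT, hcard⟩ := exists_stuck G χ fun u v huv hu => (hS huv).resolve_left hu
  exact hT.identifies (by omega)

end Identification

end WeisfeilerLeman

theorem theorem3 {V : Type*} [Fintype V] [Nonempty V] {C : Type*}
    (G : SimpleGraph V) (χ : V → C) (r : ℕ) (hr : G.vertexCoverNum = r) :
    ∃ d : ℕ, WeisfeilerLeman.IsWLDimension G χ d ∧ (d : ℚ) ≤ 2 / 3 * r + 3 := by
  obtain ⟨S, hcard, hS⟩ := G.vertexCoverNum_exists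
  lift S to Finset V using S.toFinite
  rw [hr, Set.encard_coe_eq_coe_finsetCard, Nat.cast_inj] at hcard
  have hmem : 2 * r / 3 + 3 ∈ {k | 1 ≤ k ∧ WeisfeilerLeman.Identifies k G χ} :=
    ⟨by omega, hcard ▸ WeisfeilerLeman.identifies_of_isVertexCover G χ hS⟩
  refine ⟨_, isLeast_csInf ⟨_, hmem⟩, ?_⟩
  calc ((sInf {k | 1 ≤ k ∧ WeisfeilerLeman.Identifies k G χ} : ℕ) : ℚ)
      ≤ (2 * r / 3 + 3 : ℕ) := Nat.cast_le.2 (Nat.sInf_le hmem)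
    _ ≤ 2 * r / 3 + 3 := by
      push_cast
      gcongr
      exact_mod_cast Nat.cast_div_le (α := ℚ) (m := 2 * r) (n := 3)
    _ = 2 / 3 * r + 3 := by ring
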